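/- Let $f>0$ (set-up cost per facility) and $\kappa>0$ (outbound transportation cost relative to $f$). A \emph{layout} is a nonempty locally finite set $X\subset\mathbb R^2$ of facilities such that the service region of every facility $p\in X$, i.e. its Voronoi cell $$\mathcal A_p=\{x\in\mathbb R^2:\ \|x-p\|\le\|x-q\|\ \text{ for all } q\in X\}$$ in the Euclidean norm, is bounded (hence a convex polygon). With the inbound cost ignored, the cost per unit area of the facilities within distance $R$ of the origin is $$z_R(X)=\frac{f}{\sum_{p\in X,\,\|p\|\le R}|\mathcal A_p|}\ \sum_{p\in X,\,\|p\|\le R}\Bigl(1+\kappa\int_{\mathcal A_p}\|x-p\|\,dx\Bigr),$$ and the cost per unit area of $X$ is $z(X)=\liminf_{R\to\infty}z_R(X)$. Put $$g(n)=3n^{1/2}\Bigl(\tan\frac{\pi}{n}\Bigr)^{3/2}\Bigl(\log\tan\Bigl(\frac{\pi}{2n}+\frac{\pi}{4}\Bigr)+\frac{\tan(\pi/n)}{\cos(\pi/n)}\Bigr)^{-1}.$$ Then identical regular hexagons are optimal service regions (Gersho's conjecture for the Euclidean metric): 1. the minimum of $z(X)$ over all layouts $X$ exists and equals $3\sqrt[3]{\kappa^2f^3/(4g(6)^2)}$;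 2. there is a layout all of whose service regions are regular hexagons, centred at their facilities, of area $a^*=(\kappa/2)^{-2/3}g(6)^{2/3}$. Every such layout attains the minimum, and for it $z_R(X)$ converges to the minimum as $R\to\infty$; 3. if all service regions of an optimal layout are regular hexagons of the same area $a$, centred at their facilities, then $a=a^*$. -/

import Mathlib

open Filter Topology MeasureTheory

/-- The Euclidean plane. -/
abbrev Plane : Type := EuclideanSpace ℝ (Fin 2)

/-- The service region of the facility `p` in the layout `X`: its (closed) Voronoi cell, i.e. the
customers for whom no facility of `X` is nearer than `p`. -/
def serviceRegion (X : Set Plane) (p : Plane) : Set Plane :=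
  {x | ∀ q ∈ X, dist x p ≤ dist x q}

/-- A facility layout on the infinite plane: a nonempty locally finite set of facilities all of
whose Voronoi cells are bounded (hence convex polygons; `X` is then infinite). -/
structure IsLayout (X : Set Plane) : Prop where
  nonempty : X.Nonempty
  locallyFinite : ∀ R : ℝ, (X ∩ Metric.closedBall 0 R).Finite
  bounded : ∀ p ∈ X, Bornology.IsBounded (serviceRegion X p)

/-- Facility and outbound cost per unit area of the (finitely many) facilities of `X` within
distance `R` of the origin:
`f / (∑ᵢ Aᵢ) * ∑ᵢ (1 + κ ∫_{𝒜ᵢ} ‖x - xᵢ‖ dx)`, where `𝒜ᵢ` is the whole service region of the facility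
`xᵢ` and `Aᵢ` its area. -/
noncomputable def costPerArea (f κ : ℝ) (X : Set Plane) (R : ℝ) : ℝ :=
  f / (∑ᶠ p ∈ X ∩ Metric.closedBall 0 R, volume.real (serviceRegion X p)) *
    ∑ᶠ p ∈ X ∩ Metric.closedBall 0 R, (1 + κ * ∫ x in serviceRegion X p, ‖x - p‖)

/-- The cost per unit area of the layout `X` on the whole plane (the lower limit as `R → ∞`). -/
noncomputable def averageCost (f κ : ℝ) (X : Set Plane) : EReal :=
  liminf (fun R : ℝ => (costPerArea f κ X R : EReal)) atTop

/-- `X` is an optimal layout: no layout has a smaller cost per unit area. -/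
def IsOptimalLayout (f κ : ℝ) (X : Set Plane) : Prop :=
  IsLayout X ∧ ∀ Y : Set Plane, IsLayout Y → averageCost f κ X ≤ averageCost f κ Y

/-- The regular `n`-gon with centre `c`, circumradius `s` and a vertex in direction `φ`. -/
noncomputable def regularPolygon (n : ℕ) (c : Plane) (s φ : ℝ) : Set Plane :=
  convexHull ℝ (Set.range fun k : Fin n =>
    c + s • (!₂[Real.cos (φ + 2 * Real.pi * (k : ℝ) / n),
                Real.sin (φ + 2 * Real.pi * (k : ℝ) / n)] : Plane))

/-- All service regions of `X` are regular hexagons of the same area `a`, centred at their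
facilities. -/
def HasHexagonalRegions (X : Set Plane) (a : ℝ) : Prop :=
  ∀ p ∈ X, (∃ s φ : ℝ, 0 < s ∧ serviceRegion X p = regularPolygon 6 p s φ) ∧
    volume.real (serviceRegion X p) = a

/-- `g(n) = 3 n^{1/2} (tan (π/n))^{3/2} (log tan (π/(2n) + π/4) + tan (π/n) / cos (π/n))⁻¹`. -/
noncomputable def gFun (n : ℝ) : ℝ :=
  3 * n ^ (1 / 2 : ℝ) * Real.tan (Real.pi / n) ^ (3 / 2 : ℝ) *
    (Real.log (Real.tan (Real.pi / (2 * n) + Real.pi / 4)) +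
      Real.tan (Real.pi / n) / Real.cos (Real.pi / n))⁻¹

/-- `(κ/2)^{-2/3} g(6)^{2/3}`. -/
noncomputable def optimalArea (κ : ℝ) : ℝ :=
  (κ / 2) ^ (-(2 / 3) : ℝ) * gFun 6 ^ (2 / 3 : ℝ)

/-- `3 (κ² f³ / (4 g(6)²))^{1/3}`. -/
noncomputable def optimalCost (f κ : ℝ) : ℝ :=
  3 * (κ ^ 2 * f ^ 3 / (4 * gFun 6 ^ 2)) ^ (1 / 3 : ℝ)

/-!
Every layout costs at least as much per unit area as the optimal hexagons: each Voronoi cell is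
compared with a disc, at a loss proportional to its number of sides, which is at most six on
average.

Let `s` be the circumradius of the optimal hexagons and credit served area at the rate `λ` at which
such a hexagon, with its facility, breaks even. With `H ρ = κ ρ ^ 3 / 3 - λ ρ ^ 2 / 2`, a cell with
radial function `ρ` costs `∫ H (ρ θ) dθ` besides its facility. Compare `H (ρ θ)` with `H s`: it can
be smaller only in directions where the cell ends nearer than `s`, and there it ends at the bisector
with some neighbour. The total possible gain from one bisector, as a function of its distance from
the facility alone, is largest for the apothem of the optimal hexagon
(`integral_directionalGain_le`). So a cell with `n` neighbours costs at least `2 π H s - n μ`, where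
`μ` is that largest gain, and for `n = 6` this is exactly minus the cost of the facility
(`two_pi_mul_angleCost_sub_sectorGain`).

It remains to see that `n` is at most `6` on average. For an arbitrary finite set of facilities this
needs no theory of planar graphs (`sum_card_voronoiNeighbors_le`): when a line sweeps across the
Voronoi diagram in a generic direction, the cells that it meets appear in a fixed order and during
intervals of time, and sharing an edge means being adjacent in this order at some time. A purely
combinatorial charging argument (`card_adjacent_pairs_le`) bounds the number of such pairs by three
times the number of cells.

For the facilities of a layout within distance `R` of the origin, one passes from their cells to the
larger cells in the diagram of this finite set. Within distance `s` of a facility the two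
differ only near the circle of radius `R`, so the error is `O(R)`, while the served area grows at
least like `R ^ 2` (`IsLayout.le_sum_cost`, `IsLayout.le_averageCost`).

For layouts with hexagonal regions the cost is computed exactly, in polar coordinates, and the
triangular lattice provides such a layout. Comparing areas is then a one-variable inequality.
-/

/-! ### Consecutive pairs in a changing linear order -/

/-- Elements of `P`, linearly ordered by an injective height `b`, are each present during an
interval of times. The pairs that are adjacent among the present elements at some time number at
most `3 * #P`: charge a pair, at the first time it is adjacent, to an endpoint that has just
appeared, or to the element between its endpoints that has just disappeared. -/
theorem card_adjacent_pairs_le {α : Type*} (P : Finset α) (b : α → ℝ) (hb : Set.InjOn b P)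
    (alive : ℝ → α → Prop)
    (hconv : ∀ p s t u, s ≤ t → t ≤ u → alive s p → alive u p → alive t p)
    (E : Finset (α × α))
    (hE : ∀ e ∈ E, e.1 ∈ P ∧ e.2 ∈ P ∧ b e.1 < b e.2 ∧ ∃ s, alive s e.1 ∧ alive s e.2 ∧
      ∀ r ∈ P, alive s r → ¬ (b e.1 < b r ∧ b r < b e.2)) :
    E.card ≤ 3 * P.card := by
  classical
  let adj : ℝ → α × α → Prop := fun s e => alive s e.1 ∧ alive s e.2 ∧
      ∀ r ∈ P, alive s r → ¬ (b e.1 < b r ∧ b r < b e.2)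
  have hE1 : ∀ e ∈ E, ∃ s, adj s e := fun e he => (hE e he).2.2.2
  choose! t ht using hE1
  let T : Finset ℝ := E.image t
  have hfirst : ∀ e ∈ E, ∃ s ∈ T, adj s e ∧ ∀ s' ∈ T, s' < s → ¬ adj s' e := by
    intro e he
    have hne : (T.filter (fun s => adj s e)).Nonempty :=
      ⟨t e, Finset.mem_filter.2 ⟨Finset.mem_image_of_mem t he, ht e he⟩⟩
    have hmem := Finset.min'_mem _ hne
    refine ⟨_, (Finset.mem_filter.1 hmem).1, (Finset.mem_filter.1 hmem).2, ?_⟩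
    intro s' hs' hlt hadj
    exact absurd (Finset.min'_le _ s' (Finset.mem_filter.2 ⟨hs', hadj⟩)) (not_le.2 hlt)
  choose! f hfT hfadj hfmin using hfirst
  let rel : α × α → α → Fin 3 → Prop := fun e x i =>
    (i = 0 ∧ e.2 = x ∧ ∀ s' ∈ T, s' < f e → ¬ alive s' x) ∨
    (i = 1 ∧ e.1 = x ∧ ∀ s' ∈ T, s' < f e → ¬ alive s' x) ∨
    (i = 2 ∧ b e.1 < b x ∧ b x < b e.2 ∧ ¬ alive (f e) x ∧
      ∃ s' ∈ T, s' < f e ∧ alive s' x ∧ ∀ s'' ∈ T, s'' < f e → s'' ≤ s')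
  have hex : ∀ e ∈ E, ∃ c : α × Fin 3, c.1 ∈ P ∧ rel e c.1 c.2 := by
    intro e he
    obtain ⟨hq, hp, hqp, -⟩ := hE e he
    by_cases h0 : ∀ s' ∈ T, s' < f e → ¬ alive s' e.2
    · exact ⟨(e.2, 0), hp, Or.inl ⟨rfl, rfl, h0⟩⟩
    by_cases h1 : ∀ s' ∈ T, s' < f e → ¬ alive s' e.1
    · exact ⟨(e.1, 1), hq, Or.inr (Or.inl ⟨rfl, rfl, h1⟩)⟩
    push Not at h0 h1
    obtain ⟨s0, hs0T, hs0, ha0⟩ := h0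
    obtain ⟨s1, hs1T, hs1, ha1⟩ := h1
    have hne : (T.filter (fun s => s < f e)).Nonempty :=
      ⟨s0, Finset.mem_filter.2 ⟨hs0T, hs0⟩⟩
    obtain ⟨hmT, hmlt⟩ := Finset.mem_filter.1 (Finset.max'_mem _ hne)
    have hmax : ∀ s'' ∈ T, s'' < f e → s'' ≤ (T.filter (fun s => s < f e)).max' hne :=
      fun s'' h1 h2 => Finset.le_max' _ _ (Finset.mem_filter.2 ⟨h1, h2⟩)
    set m := (T.filter (fun s => s < f e)).max' hne
    have hap : alive m e.2 := hconv _ s0 m (f e) (hmax s0 hs0T hs0) hmlt.le ha0 (hfadj e he).2.1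
    have haq : alive m e.1 := hconv _ s1 m (f e) (hmax s1 hs1T hs1) hmlt.le ha1 (hfadj e he).1
    have hnot := hfmin e he m hmT hmlt
    have : ∃ r ∈ P, alive m r ∧ b e.1 < b r ∧ b r < b e.2 := by
      by_contra hcon
      push Not at hcon
      exact hnot ⟨haq, hap, fun r hr har hh => absurd hh.2 (not_lt.2 (hcon r hr har hh.1))⟩
    obtain ⟨r, hr, har, hbr⟩ := this
    exact ⟨(r, 2), hr, Or.inr (Or.inr ⟨rfl, hbr.1, hbr.2,
      fun h => (hfadj e he).2.2 r hr h hbr, m, hmT, hmlt, har, hmax⟩)⟩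
  rcases E.eq_empty_or_nonempty with rfl | ⟨⟨x₀, _⟩, -⟩
  · simp
  have : Nonempty (α × Fin 3) := ⟨(x₀, 0)⟩
  choose! c hcP hc using hex
  have hle_bot : ∀ e ∈ E, ∀ e' ∈ E, f e = f e' → b e'.1 ≤ b e.1 ∨ b e.2 ≤ b e'.1 := by
    intro e he e' he' hf
    by_contra hcon
    push Not at hcon
    exact (hfadj e he).2.2 _ (hE e' he').1 (hf ▸ (hfadj e' he').1) hcon
  have hle_top : ∀ e ∈ E, ∀ e' ∈ E, f e = f e' → b e'.2 ≤ b e.1 ∨ b e.2 ≤ b e'.2 := by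
    intro e he e' he' hf
    by_contra hcon
    push Not at hcon
    exact (hfadj e he).2.2 _ (hE e' he').2.1 (hf ▸ (hfadj e' he').2.1) hcon
  -- Two pairs with the same first time whose height intervals overlap coincide.
  have heq : ∀ e ∈ E, ∀ e' ∈ E, f e = f e' → b e.1 < b e'.2 → b e'.1 < b e.2 → e = e' := by
    intro e he e' he' hf h1 h2
    have a1 : b e'.1 ≤ b e.1 := (hle_bot e he e' he' hf).resolve_right (not_le.2 h2)
    have a2 : b e.1 ≤ b e'.1 := (hle_bot e' he' e he hf.symm).resolve_right (not_le.2 h1)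
    have a3 : b e.2 ≤ b e'.2 := (hle_top e he e' he' hf).resolve_left (not_le.2 h1)
    have a4 : b e'.2 ≤ b e.2 := (hle_top e' he' e he hf.symm).resolve_left (not_le.2 h2)
    exact Prod.ext (hb (hE e he).1 (hE e' he').1 (le_antisymm a2 a1))
      (hb (hE e he).2.1 (hE e' he').2.1 (le_antisymm a3 a4))
  have htime : ∀ e ∈ E, ∀ e' ∈ E, ∀ x, alive (f e) x →
      (∀ s' ∈ T, s' < f e' → ¬ alive s' x) → f e' ≤ f e := by
    intro e he e' he' x hx hnew
    by_contra hcon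
    exact hnew _ (hfT e he) (not_le.1 hcon) hx
  have hinj : Set.InjOn c (E : Set (α × α)) := by
    intro e he e' he' hcc
    have he := Finset.mem_coe.1 he
    have he' := Finset.mem_coe.1 he'
    have r1 := hc e he
    have r2 := hc e' he'
    rw [← hcc] at r2
    rcases r1 with ⟨hi, hx, hnew⟩ | ⟨hi, hx, hnew⟩ | ⟨hi, hx1, hx2, hna, s1, hs1, hs1', ha1, hm1⟩
    · rcases r2 with ⟨_, hx', hnew'⟩ | ⟨hi', _⟩ | ⟨hi', _⟩
      · have hf : f e = f e' := le_antisymm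
          (htime e' he' e he _ (hx' ▸ (hfadj e' he').2.1) hnew)
          (htime e he e' he' _ (hx ▸ (hfadj e he).2.1) hnew')
        have h22 : e.2 = e'.2 := hx.trans hx'.symm
        exact heq e he e' he' hf (h22 ▸ (hE e he).2.2.1) (h22 ▸ (hE e' he').2.2.1)
      · rw [hi] at hi'; exact absurd hi' (by decide)
      · rw [hi] at hi'; exact absurd hi' (by decide)
    · rcases r2 with ⟨hi', _⟩ | ⟨_, hx', hnew'⟩ | ⟨hi', _⟩
      · rw [hi] at hi'; exact absurd hi' (by decide)
      · have hf : f e = f e' := le_antisymm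
          (htime e' he' e he _ (hx' ▸ (hfadj e' he').1) hnew)
          (htime e he e' he' _ (hx ▸ (hfadj e he).1) hnew')
        have h11 : e.1 = e'.1 := hx.trans hx'.symm
        exact heq e he e' he' hf (h11 ▸ (hE e' he').2.2.1) (h11 ▸ (hE e he).2.2.1)
      · rw [hi] at hi'; exact absurd hi' (by decide)
    · rcases r2 with ⟨hi', _⟩ | ⟨hi', _⟩ | ⟨_, hx1', hx2', hna', s2, hs2, hs2', ha2, hm2⟩
      · rw [hi] at hi'; exact absurd hi' (by decide)
      · rw [hi] at hi'; exact absurd hi' (by decide)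
      · have hf : f e = f e' := by
          rcases lt_trichotomy (f e) (f e') with h | h | h
          · exact absurd (hconv _ s1 (f e) s2 hs1'.le (hm2 _ (hfT e he) h) ha1 ha2) hna
          · exact h
          · exact absurd (hconv _ s2 (f e') s1 hs2'.le (hm1 _ (hfT e' he') h) ha2 ha1) hna'
        exact heq e he e' he' hf (hx1.trans hx2') (hx1'.trans hx2)
  calc E.card ≤ (P ×ˢ (Finset.univ : Finset (Fin 3))).card :=
        Finset.card_le_card_of_injOn c
          (fun e he => Finset.mem_coe.2 (Finset.mem_product.2 ⟨hcP e he, Finset.mem_univ _⟩)) hinj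
    _ = 3 * P.card := by rw [Finset.card_product]; simp [mul_comm]

/-! ### Neighbours in the Voronoi diagram of a finite set -/

/-- The power of the point `x` with respect to `p`, up to the summand `‖x‖ ^ 2`; it is affine in
`x`. -/
noncomputable def sitePower (p x : Plane) : ℝ :=
  (p 0 ^ 2 - 2 * x 0 * p 0) + (p 1 ^ 2 - 2 * x 1 * p 1)

theorem dist_sq_eq_sitePower (x p : Plane) :
    dist x p ^ 2 = sitePower p x + (x 0 ^ 2 + x 1 ^ 2) := by
  rw [EuclideanSpace.dist_eq, Real.sq_sqrt (by positivity)]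
  simp only [Fin.sum_univ_two, Real.dist_eq, sq_abs, sitePower]
  ring

theorem dist_lt_dist_iff_sitePower (x p q : Plane) :
    dist x p < dist x q ↔ sitePower p x < sitePower q x := by
  rw [← pow_lt_pow_iff_left₀ dist_nonneg dist_nonneg two_ne_zero, dist_sq_eq_sitePower,
    dist_sq_eq_sitePower, add_lt_add_iff_right]

theorem dist_le_dist_iff_sitePower (x p q : Plane) :
    dist x p ≤ dist x q ↔ sitePower p x ≤ sitePower q x := by
  rw [← not_lt, dist_lt_dist_iff_sitePower, not_lt]

/-- `p` and `q` are neighbours in the Voronoi diagram of `P` if some point has exactly `p` and `q`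
as its nearest points of `P`; that is, if the two cells share an edge of positive length. -/
def IsVoronoiNeighbor (P : Finset Plane) (p q : Plane) : Prop :=
  q ≠ p ∧ ∃ x, dist x p = dist x q ∧ ∀ r ∈ P, r ≠ p → r ≠ q → dist x p < dist x r

open Classical in
/-- The neighbours of `p` in the Voronoi diagram of `P`. -/
noncomputable def voronoiNeighbors (P : Finset Plane) (p : Plane) : Finset Plane :=
  P.filter (IsVoronoiNeighbor P p)

theorem IsVoronoiNeighbor.symm {P : Finset Plane} {p q : Plane} (h : IsVoronoiNeighbor P p q) :
    IsVoronoiNeighbor P q p := by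
  obtain ⟨hne, x, hx, hr⟩ := h
  exact ⟨hne.symm, x, hx.symm, fun r hrP h1 h2 => hx ▸ hr r hrP h2 h1⟩

/-- Finitely many points have distinct heights in all but finitely many directions. -/
theorem exists_injOn_height (P : Finset Plane) :
    ∃ t : ℝ, Set.InjOn (fun p : Plane => p 0 + t * p 1) (P : Set Plane) := by
  classical
  let bad : Finset ℝ := (P ×ˢ P).image fun e => -(e.1 0 - e.2 0) / (e.1 1 - e.2 1)
  obtain ⟨t, ht⟩ := Infinite.exists_notMem_finset bad
  refine ⟨t, fun p hp q hq hpq => ?_⟩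
  simp only at hpq
  have h1 : p 1 = q 1 := by
    by_contra hne
    have hne' : p 1 - q 1 ≠ 0 := sub_ne_zero.2 hne
    refine ht (Finset.mem_image.2 ⟨(p, q), Finset.mem_product.2 ⟨hp, hq⟩, ?_⟩)
    simp only
    rw [div_eq_iff hne']
    linarith
  have h0 : p 0 = q 0 := by rw [h1] at hpq; linarith
  ext i
  fin_cases i
  · exact h0
  · exact h1

/-- A Voronoi diagram of `N` points has at most `3 * N` edges, each counted here from both sides.
Sweep the plane by parallel lines in a generic direction: on each line the cells appear in
the order of the heights of their points, and two cells sharing an edge are adjacent on some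
line. -/
theorem sum_card_voronoiNeighbors_le (P : Finset Plane) :
    ∑ p ∈ P, (voronoiNeighbors P p).card ≤ 6 * P.card := by
  classical
  obtain ⟨t, ht⟩ := exists_injOn_height P
  set b : Plane → ℝ := fun p => p 0 + t * p 1 with hbdef
  let σ : Plane → ℝ := fun x => x 1 - t * x 0
  let alive : ℝ → Plane → Prop := fun s p =>
    ∃ x, σ x = s ∧ ∀ r ∈ P, r ≠ p → sitePower p x < sitePower r x
  -- Along a line of the sweep the difference of two powers is affine, with slope given by `b`.
  have hmove : ∀ (x : Plane) (τ : ℝ), ∃ y, σ y = σ x ∧ ∀ p, sitePower p y =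
      sitePower p x - 2 * τ * b p := by
    intro x τ
    refine ⟨!₂[x 0 + τ, x 1 + τ * t], ?_, ?_⟩
    · simp [σ]; ring
    · intro p; simp [sitePower, hbdef]; ring
  let E : Finset (Plane × Plane) :=
    (P ×ˢ P).filter fun e => IsVoronoiNeighbor P e.1 e.2 ∧ b e.1 < b e.2
  have hE : E.card ≤ 3 * P.card := by
    refine card_adjacent_pairs_le P b ht alive ?_ E ?_
    · rintro p s u v hsu huv ⟨x, hx, hxp⟩ ⟨y, hy, hyp⟩
      rcases hsu.eq_or_lt with rfl | hsu
      · exact ⟨x, hx, hxp⟩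
      have hd : 0 < v - s := by linarith
      set a := (u - s) / (v - s) with ha
      have ha0' : 0 < a := div_pos (by linarith) hd
      have ha1 : 0 ≤ 1 - a := by
        rw [ha, sub_nonneg, div_le_one hd]; linarith
      have hcomb : ∀ r, sitePower r (!₂[(1 - a) * x 0 + a * y 0, (1 - a) * x 1 + a * y 1]) =
          (1 - a) * sitePower r x + a * sitePower r y := by
        intro r; simp [sitePower]; ring
      refine ⟨!₂[(1 - a) * x 0 + a * y 0, (1 - a) * x 1 + a * y 1], ?_, ?_⟩
      · have : a * (v - s) = u - s := by rw [ha]; field_simp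
        simp only [σ] at hx hy ⊢
        simp only [Matrix.cons_val_zero, Matrix.cons_val_one]
        rw [← hx, ← hy] at this
        linear_combination this
      · intro r hr hrp
        rw [hcomb, hcomb]
        have h1 := mul_le_mul_of_nonneg_left (hxp r hr hrp).le ha1
        have h2 := mul_lt_mul_of_pos_left (hyp r hr hrp) ha0'
        linarith
    · rintro ⟨q, p⟩ he
      obtain ⟨hmem, ⟨-, x, hx, hr⟩, hlt⟩ := Finset.mem_filter.1 he
      obtain ⟨hq, hp⟩ := Finset.mem_product.1 hmem
      simp only at hq hp hx hr hlt ⊢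
      have hx' : sitePower q x = sitePower p x := le_antisymm
        ((dist_le_dist_iff_sitePower x q p).1 hx.le) ((dist_le_dist_iff_sitePower x p q).1 hx.ge)
      have hr' : ∀ r ∈ P, r ≠ q → r ≠ p → sitePower q x < sitePower r x :=
        fun r h1 h2 h3 => (dist_lt_dist_iff_sitePower _ _ _).1 (hr r h1 h2 h3)
      -- For small `τ` the remaining points stay strictly farther away.
      have hsmall : ∀ᶠ τ in 𝓝 (0 : ℝ), ∀ r ∈ P, r ≠ q → r ≠ p → ∀ w ∈ P,
          w = q ∨ w = p → sitePower w x - 2 * τ * b w < sitePower r x - 2 * τ * b r := by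
        rw [Filter.eventually_all_finset]
        intro r hrP
        by_cases h1 : r = q
        · exact Eventually.of_forall fun τ h => absurd h1 h
        by_cases h2 : r = p
        · exact Eventually.of_forall fun τ _ h => absurd h2 h
        simp only [ne_eq, h1, not_false_eq_true, h2, forall_const]
        rw [Filter.eventually_all_finset]
        intro w hwP
        by_cases hw : w = q ∨ w = p
        · simp only [hw, forall_const]
          have hlt : sitePower w x < sitePower r x := by
            rcases hw with rfl | rfl
            · exact hr' r hrP h1 h2
            · exact hx' ▸ hr' r hrP h1 h2
          have hc : ContinuousAt (fun τ : ℝ =>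
              (sitePower r x - 2 * τ * b r) - (sitePower w x - 2 * τ * b w)) 0 := by fun_prop
          have := hc.eventually (lt_mem_nhds (a := 0) (by simpa using hlt))
          filter_upwards [this] with τ hτ
          linarith
        · exact Eventually.of_forall fun τ h => absurd h hw
      obtain ⟨ε, hε, hball⟩ := Metric.eventually_nhds_iff.1 hsmall
      have hhalf : ∀ τ, |τ| = ε / 2 → ∀ r ∈ P, r ≠ q → r ≠ p → ∀ w ∈ P,
          w = q ∨ w = p → sitePower w x - 2 * τ * b w < sitePower r x - 2 * τ * b r := by
        intro τ hτ
        apply hball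
        rw [Real.dist_eq, sub_zero, hτ]; linarith
      refine ⟨hq, hp, hlt, σ x, ?_, ?_, ?_⟩
      · obtain ⟨y, hy1, hy2⟩ := hmove x (-(ε / 2))
        refine ⟨y, hy1, fun r hrP hrq => ?_⟩
        rw [hy2, hy2]
        by_cases hrp : r = p
        · subst hrp; nlinarith
        · exact hhalf _ (by rw [abs_neg, abs_of_pos (by linarith)]) r hrP hrq hrp q hq (Or.inl rfl)
      · obtain ⟨y, hy1, hy2⟩ := hmove x (ε / 2)
        refine ⟨y, hy1, fun r hrP hrp => ?_⟩
        rw [hy2, hy2]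
        by_cases hrq : r = q
        · subst hrq; nlinarith
        · exact hhalf _ (by rw [abs_of_pos (by linarith)]) r hrP hrq hrp p hp (Or.inr rfl)
      · rintro r hrP ⟨y, hy1, hy2⟩ ⟨h1, h2⟩
        -- `y` lies on the same line as `x`, above or below it.
        have hrq : r ≠ q := fun h => by subst h; exact lt_irrefl _ h1
        have hrp : r ≠ p := fun h => by subst h; exact lt_irrefl _ h2
        have hline : ∀ w, sitePower w y = sitePower w x - 2 * (y 0 - x 0) * b w := by
          intro w
          simp only [σ] at hy1
          have : y 1 = x 1 + t * (y 0 - x 0) := by linarith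
          simp only [sitePower, hbdef, this]; ring
        have a1 := hy2 q hq (Ne.symm hrq)
        have a2 := hy2 p hp (Ne.symm hrp)
        have a3 := hr' r hrP hrq hrp
        rw [hline, hline] at a1 a2
        rcases le_total 0 (y 0 - x 0) with h | h
        · nlinarith
        · nlinarith
  -- Every ordered pair of neighbours or its reverse is counted in `E`.
  have hsum : ∑ p ∈ P, (voronoiNeighbors P p).card =
      ((P ×ˢ P).filter fun e => IsVoronoiNeighbor P e.1 e.2).card := by
    rw [Finset.card_filter, Finset.sum_product]
    refine Finset.sum_congr rfl fun p _ => ?_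
    rw [voronoiNeighbors, Finset.card_filter]
  have hsub : ((P ×ˢ P).filter fun e => IsVoronoiNeighbor P e.1 e.2) ⊆ E ∪ E.image Prod.swap := by
    rintro ⟨p, q⟩ he
    obtain ⟨hmem, hn⟩ := Finset.mem_filter.1 he
    obtain ⟨hp, hq⟩ := Finset.mem_product.1 hmem
    rcases lt_trichotomy (b p) (b q) with h | h | h
    · exact Finset.mem_union_left _ (Finset.mem_filter.2 ⟨hmem, hn, h⟩)
    · exact absurd (ht hq hp h.symm) hn.1
    · exact Finset.mem_union_right _ (Finset.mem_image.2 ⟨(q, p), Finset.mem_filter.2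
        ⟨Finset.mem_product.2 ⟨hq, hp⟩, hn.symm, h⟩, rfl⟩)
  rw [hsum]
  calc _ ≤ (E ∪ E.image Prod.swap).card := Finset.card_le_card hsub
    _ ≤ E.card + (E.image Prod.swap).card := Finset.card_union_le _ _
    _ ≤ E.card + E.card := Nat.add_le_add_left Finset.card_image_le _
    _ ≤ 6 * P.card := by omega

/-! ### The sector inequality -/

/-- For the optimal hexagons, the ratio of `λ / κ` to the circumradius, where `λ` is their cost per
unit area relative to the set-up cost. Distances in the normalised problem are in units of the
circumradius. -/
noncomputable def hexRatio : ℝ := 1 / 2 + 3 / 8 * Real.log 3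

/-- The normalised cost of a unit angle at distance `ρ`: a primitive of `r * (r - hexRatio)`. -/
noncomputable def angleCost (ρ : ℝ) : ℝ := ρ ^ 3 / 3 - hexRatio * ρ ^ 2 / 2

/-- The primitive of `1 / cos` on `(-π / 2, π / 2)` that vanishes at `0`. -/
noncomputable def secPrimitive (θ : ℝ) : ℝ :=
  (Real.log (1 + Real.sin θ) - Real.log (1 - Real.sin θ)) / 2

/-- The amount by which cutting the unit disc by a line at distance `cos α` from its centre lowers
the normalised cost, in the directions of angle less than `α` from the normal, which are those where
the line is hit inside the disc. -/
noncomputable def sectorGain (α : ℝ) : ℝ :=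
  2 * α * (1 / 3 - hexRatio / 2) + (hexRatio - 1 / 3) * (Real.sin α * Real.cos α)
    - Real.cos α ^ 3 * secPrimitive α / 3

/-- The positive part of the gain in the direction `θ` of a line at distance `d` from the centre
of the unit disc; it vanishes where the line is not hit inside the disc. -/
noncomputable def directionalGain (d θ : ℝ) : ℝ :=
  max 0 (angleCost 1 - angleCost (d / max (Real.cos θ) d))

theorem hexRatio_lt_one : hexRatio < 1 := by
  have h : Real.log 3 < 4 / 3 := by
    rw [Real.log_lt_iff_lt_exp (by norm_num)]
    have h1 : Real.exp (4 / 3) = Real.exp 1 * Real.exp (1 / 3) := by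
      rw [← Real.exp_add]; norm_num
    have h2 := Real.add_one_le_exp (1 / 3 : ℝ)
    have h3 := Real.exp_one_gt_d9
    rw [h1]; nlinarith
  unfold hexRatio; linarith

theorem two_thirds_lt_hexRatio : 2 / 3 < hexRatio := by
  have h : (1 : ℝ) < Real.log 3 := by
    rw [Real.lt_log_iff_exp_lt (by norm_num)]
    linarith [Real.exp_one_lt_d9]
  unfold hexRatio; linarith

theorem hasDerivAt_secPrimitive {θ : ℝ} (h : 0 < Real.cos θ) :
    HasDerivAt secPrimitive (1 / Real.cos θ) θ := by
  have hsq := Real.sin_sq_add_cos_sq θ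
  have h1 : 0 < 1 + Real.sin θ := by nlinarith [Real.neg_one_le_sin θ, Real.sin_le_one θ]
  have h2 : 0 < 1 - Real.sin θ := by nlinarith [Real.neg_one_le_sin θ, Real.sin_le_one θ]
  have d1 := (((Real.hasDerivAt_sin θ).const_add 1).log h1.ne')
  have d2 := (((Real.hasDerivAt_sin θ).const_sub 1).log h2.ne')
  refine ((d1.sub d2).div_const 2).congr_deriv ?_
  have h3 : (1 + Real.sin θ) * (1 - Real.sin θ) = Real.cos θ ^ 2 := by nlinarith
  field_simp
  rw [h3]; ring

theorem secPrimitive_zero : secPrimitive 0 = 0 := by simp [secPrimitive]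

theorem secPrimitive_pi_div_six : secPrimitive (Real.pi / 6) = Real.log 3 / 2 := by
  rw [secPrimitive, Real.sin_pi_div_six, ← Real.log_div (by norm_num) (by norm_num)]
  norm_num

theorem cos_pos_of_mem_Icc_zero {α θ : ℝ} (hα : α < Real.pi / 2) (h : θ ∈ Set.Icc 0 α) :
    0 < Real.cos θ :=
  Real.cos_pos_of_mem_Ioo ⟨by linarith [h.1, Real.pi_pos], by linarith [h.2]⟩

theorem continuousOn_angleCost_div {d α : ℝ} (hα : α < Real.pi / 2) :
    ContinuousOn (fun θ => angleCost 1 - angleCost (d / Real.cos θ)) (Set.Icc 0 α) := by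
  have : ContinuousOn (fun θ => d / Real.cos θ) (Set.Icc 0 α) :=
    continuousOn_const.div Real.continuous_cos.continuousOn
      fun θ h => (cos_pos_of_mem_Icc_zero hα h).ne'
  unfold angleCost
  fun_prop

theorem integral_angleCost_div {α : ℝ} (h0 : 0 ≤ α) (hα : α < Real.pi / 2) :
    ∫ θ in (0 : ℝ)..α, (angleCost 1 - angleCost (Real.cos α / Real.cos θ)) =
      sectorGain α / 2 := by
  set d := Real.cos α with hd
  have hderiv : ∀ θ ∈ Set.uIcc 0 α, HasDerivAt (fun θ => angleCost 1 * θ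
      - d ^ 3 / 6 * (Real.sin θ / Real.cos θ ^ 2 + secPrimitive θ)
      + hexRatio * d ^ 2 / 2 * Real.tan θ)
      (angleCost 1 - angleCost (d / Real.cos θ)) θ := by
    intro θ hθ
    rw [Set.uIcc_of_le h0] at hθ
    have hc := cos_pos_of_mem_Icc_zero hα hθ
    have e1 := (hasDerivAt_id θ).const_mul (angleCost 1)
    have e2 := ((Real.hasDerivAt_sin θ).div ((Real.hasDerivAt_cos θ).pow 2)
      (pow_ne_zero 2 hc.ne')).add (hasDerivAt_secPrimitive hc)
    have e3 := (Real.hasDerivAt_tan hc.ne').const_mul (hexRatio * d ^ 2 / 2)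
    refine ((e1.sub (e2.const_mul (d ^ 3 / 6))).add e3).congr_deriv ?_
    have hs2 : Real.sin θ ^ 2 = 1 - Real.cos θ ^ 2 := by
      linarith [Real.sin_sq_add_cos_sq θ]
    simp only [angleCost, Pi.pow_apply]
    push_cast
    field_simp
    ring_nf
    rw [hs2]
    ring
  rw [intervalIntegral.integral_eq_sub_of_hasDerivAt hderiv]
  · have hc : 0 < d := cos_pos_of_mem_Icc_zero hα ⟨h0, le_rfl⟩
    simp only [Real.sin_zero, secPrimitive_zero, Real.tan_eq_sin_div_cos, ← hd,
      sectorGain, angleCost]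
    field_simp
    ring
  · apply ContinuousOn.intervalIntegrable
    rw [Set.uIcc_of_le h0]
    exact continuousOn_angleCost_div hα

/-- The derivative of `sectorGain` at `α` is `x * gainSlope x` for `x = sin α`. -/
noncomputable def gainSlope (x : ℝ) : ℝ :=
  (1 - x ^ 2) * ((Real.log (1 + x) - Real.log (1 - x)) / 2) - (2 * hexRatio - 1) * x

theorem concaveOn_gainSlope : ConcaveOn ℝ (Set.Ico 0 1) gainSlope := by
  have hd1 : ∀ x ∈ Set.Ioo (-1 : ℝ) 1, HasDerivAt gainSlope
      (-2 * x * ((Real.log (1 + x) - Real.log (1 - x)) / 2) + 1 - (2 * hexRatio - 1)) x := by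
    intro x hx
    have h1 : 0 < 1 + x := by linarith [hx.1]
    have h2 : 0 < 1 - x := by linarith [hx.2]
    have a1 := (((hasDerivAt_id x).const_add 1).log h1.ne')
    have a2 := (((hasDerivAt_id x).const_sub 1).log h2.ne')
    have a3 := (((hasDerivAt_id x).pow 2).const_sub 1).mul ((a1.sub a2).div_const 2)
    refine (a3.sub ((hasDerivAt_id x).const_mul (2 * hexRatio - 1))).congr_deriv ?_
    simp only [id, Pi.pow_apply, Pi.sub_apply]
    field_simp
    push_cast
    ring
  have hd2 : ∀ x ∈ Set.Ioo (0 : ℝ) 1, HasDerivAt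
      (fun x => -2 * x * ((Real.log (1 + x) - Real.log (1 - x)) / 2) + 1 - (2 * hexRatio - 1))
      (-(Real.log (1 + x) - Real.log (1 - x)) - x * (1 / (1 + x) + 1 / (1 - x))) x := by
    intro x hx
    have h1 : 0 < 1 + x := by linarith [hx.1]
    have h2 : 0 < 1 - x := by linarith [hx.2]
    have a1 := (((hasDerivAt_id x).const_add 1).log h1.ne')
    have a2 := (((hasDerivAt_id x).const_sub 1).log h2.ne')
    have a3 := (((hasDerivAt_id x).const_mul (-2)).mul ((a1.sub a2).div_const 2))
    refine ((a3.add_const 1).sub_const (2 * hexRatio - 1)).congr_deriv ?_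
    simp only [id, Pi.sub_apply]
    field_simp
    ring
  refine concaveOn_of_hasDerivWithinAt2_nonpos (convex_Ico 0 1)
    (f' := fun x => -2 * x * ((Real.log (1 + x) - Real.log (1 - x)) / 2) + 1 - (2 * hexRatio - 1))
    (f'' := fun x => -(Real.log (1 + x) - Real.log (1 - x)) - x * (1 / (1 + x) + 1 / (1 - x)))
    ?_ ?_ ?_ ?_
  · intro x hx
    exact (hd1 x ⟨by linarith [hx.1], hx.2⟩).continuousAt.continuousWithinAt
  · intro x hx
    rw [interior_Ico] at hx ⊢
    exact (hd1 x ⟨by linarith [hx.1], hx.2⟩).hasDerivWithinAt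
  · intro x hx
    rw [interior_Ico] at hx ⊢
    exact (hd2 x hx).hasDerivWithinAt
  · intro x hx
    rw [interior_Ico] at hx
    have h1 : 0 < 1 + x := by linarith [hx.1]
    have h2 : 0 < 1 - x := by linarith [hx.2]
    have h3 : Real.log (1 - x) ≤ Real.log (1 + x) :=
      Real.log_le_log h2 (by linarith [hx.1])
    have h4 : 0 ≤ x * (1 / (1 + x) + 1 / (1 - x)) := by
      have := hx.1
      positivity
    linarith

theorem gainSlope_zero : gainSlope 0 = 0 := by simp [gainSlope]

theorem gainSlope_half : gainSlope (1 / 2) = 0 := by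
  have : Real.log (1 + 1 / 2) - Real.log (1 - 1 / 2) = Real.log 3 := by
    rw [← Real.log_div (by norm_num) (by norm_num)]; norm_num
  rw [gainSlope, this, hexRatio]; ring

theorem gainSlope_nonneg {x : ℝ} (h0 : 0 ≤ x) (h : x ≤ 1 / 2) : 0 ≤ gainSlope x := by
  have := concaveOn_gainSlope.2 (show (0 : ℝ) ∈ Set.Ico 0 1 by simp)
    (show (1 / 2 : ℝ) ∈ Set.Ico 0 1 by norm_num) (show 0 ≤ 1 - 2 * x by linarith)
    (show 0 ≤ 2 * x by linarith) (by ring)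
  have e : (1 - 2 * x) • (0 : ℝ) + (2 * x) • (1 / 2 : ℝ) = x := by
    simp only [smul_eq_mul]; ring
  rw [e, gainSlope_zero, gainSlope_half, smul_zero, smul_zero, zero_add] at this
  exact this

theorem gainSlope_nonpos {x : ℝ} (h0 : 1 / 2 ≤ x) (h : x < 1) : gainSlope x ≤ 0 := by
  have hx : 0 < x := by linarith
  have := concaveOn_gainSlope.2 (show (0 : ℝ) ∈ Set.Ico 0 1 by simp)
    (show x ∈ Set.Ico 0 1 from ⟨hx.le, h⟩)
    (show 0 ≤ 1 - 1 / (2 * x) by rw [sub_nonneg, div_le_one (by positivity)]; linarith)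
    (show 0 ≤ 1 / (2 * x) by positivity) (by ring)
  have e : (1 - 1 / (2 * x)) • (0 : ℝ) + (1 / (2 * x)) • x = 1 / 2 := by
    simp only [smul_eq_mul]; field_simp; ring
  rw [e, gainSlope_zero, gainSlope_half, smul_zero, zero_add, smul_eq_mul] at this
  by_contra hcon
  have : 0 < 1 / (2 * x) * gainSlope x := by
    have := not_le.1 hcon
    positivity
  linarith

theorem hasDerivAt_sectorGain {α : ℝ} (h : 0 < Real.cos α) :
    HasDerivAt sectorGain (Real.sin α * gainSlope (Real.sin α)) α := by
  have e1 := ((hasDerivAt_id α).const_mul 2).mul_const (1 / 3 - hexRatio / 2)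
  have e2 := ((Real.hasDerivAt_sin α).mul (Real.hasDerivAt_cos α)).const_mul (hexRatio - 1 / 3)
  have e3 := (((Real.hasDerivAt_cos α).pow 3).mul (hasDerivAt_secPrimitive h)).div_const 3
  refine ((e1.add e2).sub e3).congr_deriv ?_
  have hs : Real.cos α ^ 2 = 1 - Real.sin α ^ 2 := by linarith [Real.sin_sq_add_cos_sq α]
  have hs3 : Real.cos α ^ 3 * (1 / Real.cos α) = Real.cos α ^ 2 := by field_simp
  simp only [gainSlope, secPrimitive, Pi.pow_apply]
  rw [hs3]
  push_cast
  ring_nf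
  rw [hs]
  ring

theorem sectorGain_le {α : ℝ} (h0 : 0 ≤ α) (h : α < Real.pi / 2) :
    sectorGain α ≤ sectorGain (Real.pi / 6) := by
  have hpi := Real.pi_pos
  have hcos : ∀ x, 0 ≤ x → x < Real.pi / 2 → 0 < Real.cos x := fun x h1 h2 =>
    Real.cos_pos_of_mem_Ioo ⟨by linarith, h2⟩
  rcases le_total α (Real.pi / 6) with hle | hle
  · have hmono : MonotoneOn sectorGain (Set.Icc 0 (Real.pi / 6)) := by
      refine monotoneOn_of_deriv_nonneg (convex_Icc _ _) ?_ ?_ ?_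
      · exact fun x hx => (hasDerivAt_sectorGain
          (hcos x hx.1 (by linarith [hx.2]))).continuousAt.continuousWithinAt
      · rw [interior_Icc]
        exact fun x hx => (hasDerivAt_sectorGain
          (hcos x hx.1.le (by linarith [hx.2]))).differentiableAt.differentiableWithinAt
      · rw [interior_Icc]
        intro x hx
        rw [(hasDerivAt_sectorGain (hcos x hx.1.le (by linarith [hx.2]))).deriv]
        have h1 : 0 ≤ Real.sin x := Real.sin_nonneg_of_nonneg_of_le_pi hx.1.le (by linarith [hx.2])
        have h2 : Real.sin x ≤ 1 / 2 := by
          rw [← Real.sin_pi_div_six]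
          exact Real.sin_le_sin_of_le_of_le_pi_div_two (by linarith [hx.1]) (by linarith) hx.2.le
        exact mul_nonneg h1 (gainSlope_nonneg h1 h2)
    exact hmono ⟨h0, hle⟩ ⟨by linarith, le_rfl⟩ hle
  · have hanti : AntitoneOn sectorGain (Set.Icc (Real.pi / 6) α) := by
      refine antitoneOn_of_deriv_nonpos (convex_Icc _ _) ?_ ?_ ?_
      · exact fun x hx => (hasDerivAt_sectorGain
          (hcos x (by linarith [hx.1]) (by linarith [hx.2]))).continuousAt.continuousWithinAt
      · rw [interior_Icc]
        exact fun x hx => (hasDerivAt_sectorGain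
          (hcos x (by linarith [hx.1])
            (by linarith [hx.2]))).differentiableAt.differentiableWithinAt
      · rw [interior_Icc]
        intro x hx
        have hc := hcos x (by linarith [hx.1]) (by linarith [hx.2])
        rw [(hasDerivAt_sectorGain hc).deriv]
        have h2 : 1 / 2 ≤ Real.sin x := by
          rw [← Real.sin_pi_div_six]
          exact Real.sin_le_sin_of_le_of_le_pi_div_two (by linarith) (by linarith [hx.2]) hx.1.le
        have h3 : Real.sin x < 1 := by nlinarith [Real.sin_sq_add_cos_sq x, Real.sin_le_one x]
        exact mul_nonpos_of_nonneg_of_nonpos (by linarith) (gainSlope_nonpos h2 h3)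
    exact hanti ⟨le_rfl, hle⟩ ⟨hle, le_rfl⟩ hle

theorem sectorGain_pi_div_six_nonneg : 0 ≤ sectorGain (Real.pi / 6) := by
  have := sectorGain_le le_rfl (by linarith [Real.pi_pos] : (0 : ℝ) < Real.pi / 2)
  simpa [sectorGain, secPrimitive_zero] using this

/-- Replacing distance `1` by `ρ` lowers the normalised cost exactly for `ρ` between `1` and a
threshold. -/
theorem exists_angleCost_threshold : ∃ ρ₀ : ℝ, 0 < ρ₀ ∧ ρ₀ < 1 ∧
    (∀ ρ, ρ₀ ≤ ρ → ρ ≤ 1 → 0 ≤ angleCost 1 - angleCost ρ) ∧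
    (∀ ρ, 0 ≤ ρ → ρ ≤ ρ₀ → angleCost 1 - angleCost ρ ≤ 0) := by
  have l1 := hexRatio_lt_one
  have l2 := two_thirds_lt_hexRatio
  set c := 1 / 3 - hexRatio / 2 with hc
  have hfac : ∀ ρ, angleCost 1 - angleCost ρ = (1 - ρ) * (ρ ^ 2 / 3 + c * ρ + c) := by
    intro ρ; rw [angleCost, angleCost, hc]; ring
  have hcont : ContinuousOn (fun ρ : ℝ => ρ ^ 2 / 3 + c * ρ + c) (Set.Icc 0 1) := by fun_prop
  obtain ⟨ρ₀, ⟨h0, h1⟩, hroot⟩ := intermediate_value_Icc (zero_le_one' ℝ) hcont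
    (show (0 : ℝ) ∈ Set.Icc _ _ from ⟨by norm_num; linarith, by norm_num; linarith⟩)
  simp only at hroot
  have h0' : 0 < ρ₀ := by
    refine h0.lt_of_ne' fun h => ?_
    rw [h] at hroot; norm_num at hroot; linarith
  have h1' : ρ₀ < 1 := by
    refine h1.lt_of_ne fun h => ?_
    rw [h] at hroot; norm_num at hroot; linarith
  have hpos : 0 < ρ₀ / 3 + c := by
    have : 0 < ρ₀ * (ρ₀ / 3 + c) := by nlinarith
    exact pos_of_mul_pos_right this h0
  have hdiff : ∀ ρ, ρ ^ 2 / 3 + c * ρ + c = (ρ - ρ₀) * (ρ / 3 + (ρ₀ / 3 + c)) := by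
    intro ρ; linear_combination hroot
  refine ⟨ρ₀, h0', h1', fun ρ ha hb => ?_, fun ρ ha hb => ?_⟩
  · rw [hfac, hdiff]
    exact mul_nonneg (by linarith) (mul_nonneg (by linarith) (by linarith))
  · rw [hfac, hdiff]
    exact mul_nonpos_of_nonneg_of_nonpos (by linarith)
      (mul_nonpos_of_nonpos_of_nonneg (by linarith) (by linarith))

theorem continuous_directionalGain {d : ℝ} (hd : 0 < d) : Continuous (directionalGain d) := by
  have : Continuous fun θ => d / max (Real.cos θ) d :=
    continuous_const.div (by fun_prop) fun θ => (lt_max_of_lt_right hd).ne'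
  unfold directionalGain angleCost
  fun_prop

theorem directionalGain_eq_zero_of_cos_le {d θ : ℝ} (hd : 0 < d) (h : Real.cos θ ≤ d) :
    directionalGain d θ = 0 := by
  rw [directionalGain, max_eq_right h, div_self hd.ne']; simp

theorem directionalGain_neg (d θ : ℝ) : directionalGain d (-θ) = directionalGain d θ := by
  rw [directionalGain, directionalGain, Real.cos_neg]

/-- The gain that the bisector with a single neighbour can bring, over all directions, is largest
for the neighbours in the optimal hexagonal pattern. For a line nearer than the threshold the
directions are reparametrised by those of the line at the threshold that are hit at
the same distance; this parametrisation does not expand angles. -/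
theorem integral_directionalGain_le {d : ℝ} (hd : 0 < d) :
    ∫ θ in (-Real.pi)..Real.pi, directionalGain d θ ≤ sectorGain (Real.pi / 6) := by
  have hpi := Real.pi_pos
  have hint : ∀ a b, IntervalIntegrable (directionalGain d) volume a b := fun a b =>
    (continuous_directionalGain hd).intervalIntegrable a b
  have heven : ∫ θ in (-Real.pi)..0, directionalGain d θ =
      ∫ θ in (0 : ℝ)..Real.pi, directionalGain d θ := by
    have := intervalIntegral.integral_comp_neg (a := 0) (b := Real.pi) (directionalGain d)
    simp only [directionalGain_neg, neg_zero] at this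
    exact this.symm
  rw [← intervalIntegral.integral_add_adjacent_intervals (hint _ 0) (hint 0 _), heven]
  suffices h : ∫ θ in (0 : ℝ)..Real.pi, directionalGain d θ ≤ sectorGain (Real.pi / 6) / 2 by
    linarith
  rcases le_or_gt 1 d with hd1 | hd1
  · have : ∀ θ, directionalGain d θ = 0 := fun θ =>
      directionalGain_eq_zero_of_cos_le hd ((Real.cos_le_one θ).trans hd1)
    simp only [this, intervalIntegral.integral_zero]
    linarith [sectorGain_pi_div_six_nonneg]
  obtain ⟨ρ₀, h0, h1, hnn, hnp⟩ := exists_angleCost_threshold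
  set α := Real.arccos d with hα
  have hcosα : Real.cos α = d := Real.cos_arccos (by linarith) hd1.le
  have hα0 : 0 ≤ α := Real.arccos_nonneg d
  have hα2 : α < Real.pi / 2 := Real.arccos_lt_pi_div_two.2 hd
  have htail : ∫ θ in α..Real.pi, directionalGain d θ = 0 := by
    rw [intervalIntegral.integral_congr (g := fun _ => (0 : ℝ))]
    · simp
    · intro θ hθ
      rw [Set.uIcc_of_le (by linarith)] at hθ
      refine directionalGain_eq_zero_of_cos_le hd ?_
      rw [← hcosα]
      exact Real.cos_le_cos_of_nonneg_of_le_pi hα0 hθ.2 hθ.1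
  rw [← intervalIntegral.integral_add_adjacent_intervals (hint 0 α) (hint α _), htail, add_zero]
  have hcos : ∀ θ ∈ Set.Icc 0 α, d ≤ Real.cos θ := by
    intro θ hθ
    rw [← hcosα]
    exact Real.cos_le_cos_of_nonneg_of_le_pi hθ.1 (by linarith) hθ.2
  have hmid : ∀ θ ∈ Set.Icc 0 α, directionalGain d θ =
      max 0 (angleCost 1 - angleCost (d / Real.cos θ)) := by
    intro θ hθ
    rw [directionalGain, max_eq_left (hcos θ hθ)]
  rcases le_or_gt ρ₀ d with hρ | hρ
  · calc ∫ θ in (0 : ℝ)..α, directionalGain d θ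
        = ∫ θ in (0 : ℝ)..α, (angleCost 1 - angleCost (Real.cos α / Real.cos θ)) := by
          refine intervalIntegral.integral_congr fun θ hθ => ?_
          rw [Set.uIcc_of_le hα0] at hθ
          have hc := hcos θ hθ
          rw [hmid θ hθ, hcosα, max_eq_right]
          refine hnn _ (hρ.trans ?_) ((div_le_one (by linarith)).2 hc)
          exact le_div_self hd.le (by linarith) (Real.cos_le_one θ)
      _ = sectorGain α / 2 := integral_angleCost_div hα0 hα2
      _ ≤ _ := by linarith [sectorGain_le hα0 hα2]
  -- Now the line is nearer than the threshold.
  set e := d / ρ₀ with he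
  have he0 : 0 < e := by positivity
  have he1 : e < 1 := by rw [he, div_lt_one h0]; exact hρ
  have heρ : e * ρ₀ = d := by rw [he]; field_simp
  set β := Real.arccos e with hβ
  have hcosβ : Real.cos β = e := Real.cos_arccos (by linarith) he1.le
  have hβ0 : 0 ≤ β := Real.arccos_nonneg e
  have hβα : β ≤ α := Real.arccos_le_arccos (by nlinarith)
  have hhead : ∫ θ in (0 : ℝ)..β, directionalGain d θ = 0 := by
    rw [intervalIntegral.integral_congr (g := fun _ => (0 : ℝ))]
    · simp
    · intro θ hθ
      rw [Set.uIcc_of_le hβ0] at hθ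
      simp only
      rw [hmid θ ⟨hθ.1, hθ.2.trans hβα⟩, max_eq_left]
      have hc : e ≤ Real.cos θ := by
        rw [← hcosβ]
        exact Real.cos_le_cos_of_nonneg_of_le_pi hθ.1 (by linarith) hθ.2
      have hc0 : 0 < Real.cos θ := he0.trans_le hc
      refine hnp _ (by positivity) ?_
      rw [div_le_iff₀ hc0, ← heρ]
      nlinarith
  rw [← intervalIntegral.integral_add_adjacent_intervals (hint 0 β) (hint β _), hhead, zero_add]
  set α₀ := Real.arccos ρ₀
  have hcosα₀ : Real.cos α₀ = ρ₀ := Real.cos_arccos (by linarith) h1.le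
  have hα₀0 : 0 ≤ α₀ := Real.arccos_nonneg ρ₀
  have hα₀2 : α₀ < Real.pi / 2 := Real.arccos_lt_pi_div_two.2 h0
  let φ : ℝ → ℝ := fun t => Real.arccos (e * Real.cos t)
  let φ' : ℝ → ℝ := fun t => e * Real.sin t / √(1 - (e * Real.cos t) ^ 2)
  have hlt : ∀ t, |e * Real.cos t| < 1 := by
    intro t
    rw [abs_mul, abs_of_pos he0]
    have := Real.abs_cos_le_one t
    nlinarith [abs_nonneg (Real.cos t)]
  have hsqrt : ∀ t, 0 < 1 - (e * Real.cos t) ^ 2 := by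
    intro t
    have := (sq_lt_one_iff_abs_lt_one _).2 (hlt t)
    linarith
  have hφ : ∀ t ∈ Set.uIcc 0 α₀, HasDerivAt φ (φ' t) t := by
    intro t _
    have hl := abs_lt.1 (hlt t)
    refine ((Real.hasDerivAt_arccos hl.1.ne' hl.2.ne).comp t
      ((Real.hasDerivAt_cos t).const_mul e)).congr_deriv ?_
    simp only [φ']
    ring
  have hφ'c : Continuous φ' := by
    refine Continuous.div (by fun_prop) (by fun_prop) fun t => (Real.sqrt_pos.2 (hsqrt t)).ne'
  have hsub := intervalIntegral.integral_comp_mul_deriv hφ hφ'c.continuousOn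
    (continuous_directionalGain hd)
  have hφ0 : φ 0 = β := by simp [φ, hβ]
  have hφ1 : φ α₀ = α := by simp only [φ, hcosα₀, heρ, hα]
  rw [hφ0, hφ1] at hsub
  rw [← hsub]
  calc ∫ t in (0 : ℝ)..α₀, (directionalGain d ∘ φ) t * φ' t
      ≤ ∫ t in (0 : ℝ)..α₀, (angleCost 1 - angleCost (Real.cos α₀ / Real.cos t)) := by
        refine intervalIntegral.integral_mono_on hα₀0 ?_ ?_ ?_
        · refine Continuous.intervalIntegrable ?_ _ _
          exact ((continuous_directionalGain hd).comp
            (Real.continuous_arccos.comp (by fun_prop))).mul hφ'c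
        · apply ContinuousOn.intervalIntegrable
          rw [Set.uIcc_of_le hα₀0]
          exact continuousOn_angleCost_div hα₀2
        · intro t ht
          have hc0 := cos_pos_of_mem_Icc_zero hα₀2 ht
          have hc : ρ₀ ≤ Real.cos t := by
            rw [← hcosα₀]
            exact Real.cos_le_cos_of_nonneg_of_le_pi ht.1 (by linarith) ht.2
          have hl := abs_lt.1 (hlt t)
          have hk : 0 ≤ angleCost 1 - angleCost (ρ₀ / Real.cos t) :=
            hnn _ (le_div_self h0.le hc0 (Real.cos_le_one t)) ((div_le_one hc0).2 hc)
          have hval : directionalGain d (φ t) = angleCost 1 - angleCost (ρ₀ / Real.cos t) := by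
            have : d / (e * Real.cos t) = ρ₀ / Real.cos t := by
              rw [← heρ]; field_simp
            simp only [directionalGain, φ]
            rw [Real.cos_arccos hl.1.le hl.2.le,
              max_eq_left (a := e * Real.cos t) (by nlinarith), this, max_eq_right hk]
          have hφ'1 : φ' t ≤ 1 := by
            simp only [φ']
            rw [div_le_one (Real.sqrt_pos.2 (hsqrt t))]
            apply Real.le_sqrt_of_sq_le
            have h3 : (e * Real.sin t) ^ 2 + (e * Real.cos t) ^ 2 = e ^ 2 := by
              rw [mul_pow, mul_pow, ← mul_add, Real.sin_sq_add_cos_sq, mul_one]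
            nlinarith
          simp only [Function.comp_apply, hcosα₀]
          rw [hval]
          exact mul_le_of_le_one_right hk hφ'1
    _ = sectorGain α₀ / 2 := integral_angleCost_div hα₀0 hα₀2
    _ ≤ _ := by linarith [sectorGain_le hα₀0 hα₀2]

/-! ### Polar coordinates in the plane -/

/-- The unit vector of the plane in the direction `θ`. -/
noncomputable def unitVec (θ : ℝ) : Plane := !₂[Real.cos θ, Real.sin θ]

theorem dist_add_smul_unitVec (p : Plane) {r : ℝ} (hr : 0 ≤ r) (θ : ℝ) :
    dist (p + r • unitVec θ) p = r := by
  rw [dist_eq_norm, add_sub_cancel_left, EuclideanSpace.norm_eq, Real.sqrt_eq_iff_eq_sq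
    (by positivity) hr]
  simp only [Fin.sum_univ_two, unitVec, PiLp.smul_apply, Matrix.cons_val_zero,
    Matrix.cons_val_one, smul_eq_mul, Real.norm_eq_abs, sq_abs]
  linear_combination r ^ 2 * Real.sin_sq_add_cos_sq θ

theorem exists_eq_smul_unitVec {v : Plane} (hv : v ≠ 0) : ∃ r τ : ℝ, 0 < r ∧ v = r • unitVec τ := by
  have hz : (⟨v 0, v 1⟩ : ℂ) ≠ 0 := by
    intro h
    apply hv
    ext i
    fin_cases i
    · exact congrArg Complex.re h
    · exact congrArg Complex.im h
  refine ⟨‖(⟨v 0, v 1⟩ : ℂ)‖, Complex.arg ⟨v 0, v 1⟩, norm_pos_iff.2 hz, ?_⟩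
  ext i
  fin_cases i
  · simp [unitVec, Complex.norm_mul_cos_arg]
  · simp [unitVec, Complex.norm_mul_sin_arg]

theorem continuous_unitVec : Continuous unitVec := by
  unfold unitVec
  fun_prop

theorem integral_eq_integral_polar (p : Plane) (F : Plane → ℝ) :
    ∫ x, F x = ∫ q in Set.Ioi (0 : ℝ) ×ˢ Set.Ioo (-Real.pi) Real.pi,
      q.1 * F (p + q.1 • unitVec q.2) := by
  have e : MeasurePreserving
      (fun z : ℝ × ℝ => (!₂[z.1, z.2] : Plane)) := by
    exact (PiLp.volume_preserving_toLp (Fin 2)).comp (volume_preserving_finTwoArrow ℝ).symm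
  have emb : MeasurableEmbedding (fun z : ℝ × ℝ => (!₂[z.1, z.2] : Plane)) :=
    ((MeasurableEquiv.finTwoArrow (α := ℝ)).symm.trans
      (MeasurableEquiv.toLp 2 (Fin 2 → ℝ))).measurableEmbedding
  rw [← integral_add_left_eq_self F p, ← e.integral_comp emb,
    ← integral_comp_polarCoord_symm]
  refine setIntegral_congr_fun (by measurability) fun q _ => ?_
  simp only [polarCoord_symm_apply, smul_eq_mul, unitVec]
  congr 3
  ext i
  fin_cases i <;> simp

/-- The integral of a radial affine function over a set that is star-shaped about `p`, with radial
function `ρ`, in polar coordinates. -/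
theorem setIntegral_starShaped (p : Plane) {S : Set Plane} (hS : MeasurableSet S) {M : ℝ}
    (ρ : ℝ → ℝ) (hρ : ∀ θ, 0 ≤ ρ θ ∧ ρ θ ≤ M)
    (hmem : ∀ θ r, 0 < r → (p + r • unitVec θ ∈ S ↔ r ≤ ρ θ)) (a b : ℝ) :
    IntervalIntegrable (fun θ => a * ρ θ ^ 3 / 3 + b * ρ θ ^ 2 / 2) volume (-Real.pi) Real.pi ∧
    ∫ x in S, (a * dist x p + b) =
      ∫ θ in (-Real.pi)..Real.pi, (a * ρ θ ^ 3 / 3 + b * ρ θ ^ 2 / 2) := by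
  have hpi := Real.pi_pos
  have hM : 0 ≤ M := (hρ 0).1.trans (hρ 0).2
  set F : Plane → ℝ := S.indicator fun x => a * dist x p + b with hF
  set G : ℝ × ℝ → ℝ := fun q => q.1 * F (p + q.1 • unitVec q.2) with hG
  have hGmeas : Measurable G := by
    have h1 : Measurable F := Measurable.indicator (by fun_prop) hS
    have h2 : Continuous fun q : ℝ × ℝ => p + q.1 • unitVec q.2 := by
      have := continuous_unitVec
      fun_prop
    exact measurable_fst.mul (h1.comp h2.measurable)
  have hGval : ∀ θ r, 0 < r → G (r, θ) =
      (Set.Iic (ρ θ)).indicator (fun r => r * (a * r + b)) r := by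
    intro θ r hr
    by_cases h : r ≤ ρ θ
    · rw [Set.indicator_of_mem (Set.mem_Iic.2 h)]
      simp only [hG, hF]
      rw [Set.indicator_of_mem ((hmem θ r hr).2 h), dist_add_smul_unitVec p hr.le]
    · rw [Set.indicator_of_notMem (by simpa using h)]
      simp only [hG, hF]
      rw [Set.indicator_of_notMem (by rw [hmem θ r hr]; exact h), mul_zero]
  have hGint : IntegrableOn G (Set.Ioi (0 : ℝ) ×ˢ Set.Ioo (-Real.pi) Real.pi) := by
    have hfin : IntegrableOn G (Set.Ioc (0 : ℝ) M ×ˢ Set.Ioo (-Real.pi) Real.pi) := by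
      refine Measure.integrableOn_of_bounded (M := M * (|a| * M + |b|)) ?_
        hGmeas.aestronglyMeasurable ?_
      · rw [Measure.volume_eq_prod, Measure.prod_prod]
        simp [ENNReal.mul_eq_top]
      · refine (ae_restrict_iff' (by measurability)).2 (Eventually.of_forall ?_)
        rintro ⟨r, θ⟩ ⟨⟨hr0, hrM⟩, -⟩
        simp only at hr0 hrM
        rw [hGval θ r hr0]
        by_cases h : r ≤ ρ θ
        · rw [Set.indicator_of_mem (Set.mem_Iic.2 h), Real.norm_eq_abs, abs_mul, abs_of_pos hr0]
          have h1 : |a * r + b| ≤ |a| * M + |b| := by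
            refine (abs_add_le _ _).trans ?_
            rw [abs_mul, abs_of_pos hr0]
            gcongr
          gcongr
        · rw [Set.indicator_of_notMem (by simpa using h), norm_zero]
          positivity
    refine hfin.of_forall_sdiff_eq_zero (by measurability) ?_
    rintro ⟨r, θ⟩ ⟨⟨hr, hθ⟩, hn⟩
    have hr : 0 < r := hr
    rw [hGval θ r hr, Set.indicator_of_notMem]
    intro h
    exact hn ⟨⟨hr, (Set.mem_Iic.1 h).trans (hρ θ).2⟩, hθ⟩
  have hinner : ∀ θ, ∫ r in Set.Ioi (0 : ℝ), G (r, θ) = a * ρ θ ^ 3 / 3 + b * ρ θ ^ 2 / 2 := by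
    intro θ
    rw [setIntegral_congr_fun measurableSet_Ioi (fun r hr => hGval θ r hr),
      setIntegral_indicator measurableSet_Iic, Set.Ioi_inter_Iic,
      ← intervalIntegral.integral_of_le (hρ θ).1]
    rw [intervalIntegral.integral_eq_sub_of_hasDerivAt
      (f := fun r => a * r ^ 3 / 3 + b * r ^ 2 / 2)]
    · ring
    · intro r _
      refine ((((hasDerivAt_id r).pow 3).const_mul a).div_const 3 |>.add
        ((((hasDerivAt_id r).pow 2).const_mul b).div_const 2)).congr_deriv ?_
      simp only [id]; push_cast; ring
    · exact Continuous.intervalIntegrable (by fun_prop) _ _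
  have hGint' : Integrable G ((volume.restrict (Set.Ioi (0 : ℝ))).prod
      (volume.restrict (Set.Ioo (-Real.pi) Real.pi))) := by
    rw [Measure.prod_restrict]
    exact hGint
  constructor
  · rw [intervalIntegrable_iff_integrableOn_Ioo_of_le (by linarith)]
    have := hGint'.integral_prod_right
    simp only [hinner] at this
    exact this
  · rw [← integral_indicator hS, integral_eq_integral_polar p, intervalIntegral.integral_of_le
      (by linarith), integral_Ioc_eq_integral_Ioo]
    rw [Measure.volume_eq_prod, ← Measure.prod_restrict, integral_prod_symm _ hGint']
    simp only [hinner]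

/-! ### Cost of a Voronoi cell -/

theorem dist_sq_sub_dist_sq (p : Plane) (r d θ τ : ℝ) :
    dist (p + r • unitVec θ) (p + (2 * d) • unitVec τ) ^ 2 - dist (p + r • unitVec θ) p ^ 2 =
      4 * d * (d - r * Real.cos (θ - τ)) := by
  rw [dist_sq_eq_sitePower, dist_sq_eq_sitePower, Real.cos_sub]
  simp only [sitePower, unitVec, PiLp.add_apply, PiLp.smul_apply, Matrix.cons_val_zero,
    Matrix.cons_val_one, smul_eq_mul]
  linear_combination 4 * d ^ 2 * Real.sin_sq_add_cos_sq τ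

theorem dist_le_dist_add_smul_iff (p : Plane) {d : ℝ} (hd : 0 < d) (r θ τ : ℝ) :
    dist (p + r • unitVec θ) p ≤ dist (p + r • unitVec θ) (p + (2 * d) • unitVec τ) ↔
      r * Real.cos (θ - τ) ≤ d := by
  rw [← pow_le_pow_iff_left₀ dist_nonneg dist_nonneg two_ne_zero, ← sub_nonneg,
    dist_sq_sub_dist_sq, mul_nonneg_iff_of_pos_left (by positivity), sub_nonneg]

theorem dist_add_smul_le_dist_iff (p : Plane) {d : ℝ} (hd : 0 < d) (r θ τ : ℝ) :
    dist (p + r • unitVec θ) (p + (2 * d) • unitVec τ) ≤ dist (p + r • unitVec θ) p ↔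
      d ≤ r * Real.cos (θ - τ) := by
  rw [← pow_le_pow_iff_left₀ dist_nonneg dist_nonneg two_ne_zero, ← sub_nonpos,
    dist_sq_sub_dist_sq, ← neg_nonneg, ← mul_neg, mul_nonneg_iff_of_pos_left (by positivity),
    neg_nonneg, sub_nonpos]

theorem countable_setOf_mul_cos_sub_eq {A B τ τ' : ℝ}
    (h : A • unitVec τ ≠ B • unitVec τ') :
    {θ : ℝ | A * Real.cos (θ - τ) = B * Real.cos (θ - τ')}.Countable := by
  obtain ⟨r, σ, hr, hv⟩ := exists_eq_smul_unitVec (sub_ne_zero.2 h)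
  have h0 := congrArg (fun v : Plane => v 0) hv
  have h1 := congrArg (fun v : Plane => v 1) hv
  simp only [unitVec, PiLp.sub_apply, PiLp.smul_apply, Matrix.cons_val_zero, Matrix.cons_val_one,
    smul_eq_mul] at h0 h1
  refine (Set.countable_range fun k : ℤ => (2 * k + 1) * Real.pi / 2 + σ).mono ?_
  intro θ hθ
  have hθ : A * Real.cos (θ - τ) = B * Real.cos (θ - τ') := hθ
  have hz : Real.cos (θ - σ) = 0 := by
    have : r * Real.cos (θ - σ) = 0 := by
      rw [Real.cos_sub] at hθ ⊢
      rw [Real.cos_sub] at hθ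
      linear_combination hθ - Real.cos θ * h0 - Real.sin θ * h1
    exact (mul_eq_zero.1 this).resolve_left hr.ne'
  obtain ⟨k, hk⟩ := Real.cos_eq_zero_iff.1 hz
  exact ⟨k, by simp only; linarith⟩

theorem measurableSet_serviceRegion (X : Set Plane) (p : Plane) :
    MeasurableSet (serviceRegion X p) := by
  have : serviceRegion X p = ⋂ q ∈ X, {x | dist x p ≤ dist x q} := by
    ext x; simp [serviceRegion]
  rw [this]
  exact (isClosed_biInter fun q _ => isClosed_le (by fun_prop) (by fun_prop)).measurableSet

/-- Up to distance `s`, a Voronoi cell costs no less than a full disc of radius `s`, except for a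
fixed gain for every neighbour. The facility cost is not included, and the area is
charged at the rate `κ * hexRatio * s`. -/
theorem le_setIntegral_serviceRegion_inter_closedBall (P : Finset Plane) {p : Plane}
    {κ s : ℝ} (hκ : 0 < κ) (hs : 0 < s) :
    κ * s ^ 3 * (2 * Real.pi * angleCost 1
      - (voronoiNeighbors P p).card * sectorGain (Real.pi / 6)) ≤
    ∫ x in serviceRegion P p ∩ Metric.closedBall p s, (κ * dist x p + -(κ * hexRatio * s)) := by
  classical
  have hpi := Real.pi_pos
  have hpolar : ∀ q ∈ P.erase p, ∃ d τ : ℝ, 0 < d ∧ q = p + (2 * d) • unitVec τ := by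
    intro q hq
    obtain ⟨r, τ, hr, hv⟩ := exists_eq_smul_unitVec (sub_ne_zero.2 (Finset.ne_of_mem_erase hq))
    exact ⟨r / 2, τ, by positivity, by rw [mul_div_cancel₀ _ two_ne_zero, ← hv]; abel⟩
  choose! d τ hd hq using hpolar
  -- The distances at which the ray in direction `θ` leaves the disc and the half-planes.
  let exits : ℝ → Finset ℝ := fun θ => insert s
    (((P.erase p).filter fun q => 0 < Real.cos (θ - τ q)).image fun q =>
      d q / Real.cos (θ - τ q))
  have hne : ∀ θ, (exits θ).Nonempty := fun θ => Finset.insert_nonempty _ _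
  let ρ : ℝ → ℝ := fun θ => (exits θ).min' (hne θ)
  have hρs : ∀ θ, ρ θ ≤ s := fun θ => Finset.min'_le _ _ (Finset.mem_insert_self _ _)
  have hρcases : ∀ θ, ρ θ = s ∨ ∃ q ∈ P.erase p, 0 < Real.cos (θ - τ q) ∧
      ρ θ = d q / Real.cos (θ - τ q) := by
    intro θ
    rcases Finset.mem_insert.1 (Finset.min'_mem _ (hne θ)) with h | h
    · exact Or.inl h
    · obtain ⟨q, hq, hqe⟩ := Finset.mem_image.1 h
      obtain ⟨hq1, hq2⟩ := Finset.mem_filter.1 hq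
      exact Or.inr ⟨q, hq1, hq2, hqe.symm⟩
  have hρ0 : ∀ θ, 0 < ρ θ := by
    intro θ
    rcases hρcases θ with h | ⟨q, hq, hc, h⟩
    · rw [h]; exact hs
    · rw [h]; exact div_pos (hd q hq) hc
  have hle : ∀ θ r, 0 < r → (r ≤ ρ θ ↔ r ≤ s ∧ ∀ q ∈ P.erase p, r * Real.cos (θ - τ q) ≤ d q) := by
    intro θ r hr
    rw [Finset.le_min'_iff]
    constructor
    · intro h
      refine ⟨h s (Finset.mem_insert_self _ _), fun q hq => ?_⟩
      rcases le_or_gt (Real.cos (θ - τ q)) 0 with hc | hc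
      · exact (mul_nonpos_of_nonneg_of_nonpos hr.le hc).trans (hd q hq).le
      · rw [← le_div_iff₀ hc]
        exact h _ (Finset.mem_insert_of_mem (Finset.mem_image.2
          ⟨q, Finset.mem_filter.2 ⟨hq, hc⟩, rfl⟩))
    · rintro ⟨h1, h2⟩ y hy
      rcases Finset.mem_insert.1 hy with rfl | hy
      · exact h1
      · obtain ⟨q, hq, rfl⟩ := Finset.mem_image.1 hy
        obtain ⟨hq1, hq2⟩ := Finset.mem_filter.1 hq
        rw [le_div_iff₀ hq2]
        exact h2 q hq1
  have hdist : ∀ θ r, ∀ q ∈ P.erase p,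
      (dist (p + r • unitVec θ) p ≤ dist (p + r • unitVec θ) q ↔
        r * Real.cos (θ - τ q) ≤ d q) := by
    intro θ r q hqP
    have := dist_le_dist_add_smul_iff p (hd q hqP) r θ (τ q)
    rwa [← hq q hqP] at this
  have hdist' : ∀ θ r, ∀ q ∈ P.erase p,
      (dist (p + r • unitVec θ) q ≤ dist (p + r • unitVec θ) p ↔
        d q ≤ r * Real.cos (θ - τ q)) := by
    intro θ r q hqP
    have := dist_add_smul_le_dist_iff p (hd q hqP) r θ (τ q)
    rwa [← hq q hqP] at this
  have hmem : ∀ θ r, 0 < r →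
      (p + r • unitVec θ ∈ serviceRegion P p ∩ Metric.closedBall p s ↔ r ≤ ρ θ) := by
    intro θ r hr
    rw [hle θ r hr, Set.mem_inter_iff, Metric.mem_closedBall, dist_add_smul_unitVec p hr.le,
      and_comm]
    refine and_congr_right fun _ => ⟨fun h q hqP => ?_, fun h q hqP => ?_⟩
    · exact (hdist θ r q hqP).1 (h q (Finset.mem_coe.2 (Finset.mem_of_mem_erase hqP)))
    · by_cases hqp : q = p
      · rw [hqp]
      · have := Finset.mem_erase.2 ⟨hqp, Finset.mem_coe.1 hqP⟩
        exact (hdist θ r q this).2 (h q this)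
  obtain ⟨hint, hval⟩ := setIntegral_starShaped p
    ((measurableSet_serviceRegion (P : Set Plane) p).inter measurableSet_closedBall)
    ρ (fun θ => ⟨(hρ0 θ).le, hρs θ⟩) hmem κ (-(κ * hexRatio * s))
  rw [hval]
  -- In almost every direction the ray from `p` avoids the points equidistant from two other sites.
  have hgood : ∀ᵐ θ : ℝ, ∀ q ∈ P.erase p, ∀ r ∈ P.erase p, q ≠ r →
      d r * Real.cos (θ - τ q) ≠ d q * Real.cos (θ - τ r) := by
    rw [Filter.eventually_all_finset]
    intro q hqP
    rw [Filter.eventually_all_finset]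
    intro r hrP
    by_cases hqr : q = r
    · exact Eventually.of_forall fun θ h => absurd hqr h
    · have hv : d r • unitVec (τ q) ≠ d q • unitVec (τ r) := by
        intro h
        have hdd : d r = d q := by
          have h1 := dist_add_smul_unitVec 0 (hd r hrP).le (τ q)
          have h2 := dist_add_smul_unitVec 0 (hd q hqP).le (τ r)
          rw [h] at h1
          rw [← h1, h2]
        apply hqr
        rw [hq q hqP, hq r hrP, hdd, mul_smul, mul_smul, ← h, hdd]
      have := (countable_setOf_mul_cos_sub_eq hv).ae_notMem volume
      filter_upwards [this] with θ hθ _ using hθ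
  have hpoint : ∀ᵐ θ : ℝ, κ * s ^ 3 * (angleCost 1
      - ∑ q ∈ voronoiNeighbors P p, directionalGain (d q / s) (θ - τ q)) ≤
      κ * ρ θ ^ 3 / 3 + -(κ * hexRatio * s) * ρ θ ^ 2 / 2 := by
    filter_upwards [hgood] with θ hθ
    have hH : κ * ρ θ ^ 3 / 3 + -(κ * hexRatio * s) * ρ θ ^ 2 / 2 =
        κ * s ^ 3 * angleCost (ρ θ / s) := by
      rw [angleCost]; field_simp; ring
    rw [hH]
    have hnn : ∀ q, 0 ≤ directionalGain (d q / s) (θ - τ q) := fun q => le_max_left _ _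
    gcongr
    rcases (hρs θ).eq_or_lt with h | h
    · rw [h, div_self hs.ne']
      linarith [Finset.sum_nonneg fun q (_ : q ∈ voronoiNeighbors P p) => hnn q]
    obtain ⟨q, hqP, hc, hρq⟩ := (hρcases θ).resolve_left h.ne
    have hnb : q ∈ voronoiNeighbors P p := by
      refine Finset.mem_filter.2
        ⟨Finset.mem_of_mem_erase hqP, Finset.ne_of_mem_erase hqP, p + ρ θ • unitVec θ, ?_, ?_⟩
      · have hcell := (hmem θ _ (hρ0 θ)).2 le_rfl
        refine le_antisymm (hcell.1 q (Finset.mem_coe.2 (Finset.mem_of_mem_erase hqP))) ?_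
        rw [hdist' θ _ q hqP, hρq]
        field_simp
        rfl
      · intro r hrP hrp hrq
        have hrP' : r ∈ P.erase p := Finset.mem_erase.2 ⟨hrp, hrP⟩
        have hcell := (hmem θ _ (hρ0 θ)).2 le_rfl
        refine lt_of_le_of_ne (hcell.1 r (Finset.mem_coe.2 hrP)) fun heq => ?_
        have h1 : ρ θ * Real.cos (θ - τ r) = d r :=
          le_antisymm ((hdist θ _ r hrP').1 heq.le) ((hdist' θ _ r hrP').1 heq.ge)
        have h2 : ρ θ * Real.cos (θ - τ q) = d q := by rw [hρq]; field_simp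
        refine hθ q hqP r hrP' (Ne.symm hrq) ?_
        rw [← h2, ← h1]; ring
    have hsingle := Finset.single_le_sum (f := fun q => directionalGain (d q / s) (θ - τ q))
      (fun q _ => hnn q) hnb
    have hgain : angleCost 1 - angleCost (ρ θ / s) ≤ directionalGain (d q / s) (θ - τ q) := by
      rw [directionalGain, max_eq_left (a := Real.cos (θ - τ q))]
      · have : d q / s / Real.cos (θ - τ q) = ρ θ / s := by rw [hρq]; field_simp
        rw [this]
        exact le_max_right _ _
      · rw [hρq, div_lt_iff₀ hc] at h
        rw [div_le_iff₀ hs]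
        linarith
    linarith
  have hd' : ∀ q ∈ voronoiNeighbors P p, 0 < d q / s := fun q hqn =>
    div_pos (hd q (Finset.mem_erase.2
      ⟨(Finset.mem_filter.1 hqn).2.1, (Finset.mem_filter.1 hqn).1⟩)) hs
  have hcont : ∀ q ∈ voronoiNeighbors P p,
      Continuous fun θ => directionalGain (d q / s) (θ - τ q) := fun q hqn =>
    (continuous_directionalGain (hd' q hqn)).comp (by fun_prop)
  have hsumc : Continuous fun θ =>
      ∑ q ∈ voronoiNeighbors P p, directionalGain (d q / s) (θ - τ q) :=
    continuous_finsetSum _ hcont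
  have hgainint : ∀ q ∈ voronoiNeighbors P p,
      ∫ θ in (-Real.pi)..Real.pi, directionalGain (d q / s) (θ - τ q) ≤
        sectorGain (Real.pi / 6) := by
    intro q hqn
    have hper : Function.Periodic (directionalGain (d q / s)) (2 * Real.pi) := fun θ => by
      simp only [directionalGain, Real.cos_add_two_pi]
    have h1 := hper.intervalIntegral_add_eq (-Real.pi - τ q) (-Real.pi)
    rw [show -Real.pi - τ q + 2 * Real.pi = Real.pi - τ q by ring,
      show -Real.pi + 2 * Real.pi = Real.pi by ring] at h1
    rw [intervalIntegral.integral_comp_sub_right (directionalGain (d q / s)), h1]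
    exact integral_directionalGain_le (hd' q hqn)
  calc κ * s ^ 3 * (2 * Real.pi * angleCost 1
        - (voronoiNeighbors P p).card * sectorGain (Real.pi / 6))
      ≤ κ * s ^ 3 * (2 * Real.pi * angleCost 1 - ∑ q ∈ voronoiNeighbors P p,
        ∫ θ in (-Real.pi)..Real.pi, directionalGain (d q / s) (θ - τ q)) := by
        gcongr
        rw [← nsmul_eq_mul]
        exact Finset.sum_le_card_nsmul _ _ _ hgainint
    _ = ∫ θ in (-Real.pi)..Real.pi, κ * s ^ 3 * (angleCost 1
          - ∑ q ∈ voronoiNeighbors P p, directionalGain (d q / s) (θ - τ q)) := by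
        rw [intervalIntegral.integral_const_mul, intervalIntegral.integral_sub
          (by simp) (hsumc.intervalIntegrable _ _), intervalIntegral.integral_finsetSum
          (fun q hqn => (hcont q hqn).intervalIntegrable _ _)]
        simp only [intervalIntegral.integral_const, smul_eq_mul]
        ring
    _ ≤ _ := by
        refine intervalIntegral.integral_mono_ae (by linarith) ?_ hint hpoint
        exact (continuous_const.mul (continuous_const.sub hsumc)).intervalIntegrable _ _

/-! ### The lower bound for layouts -/

theorem volume_setOf_dist_eq {p q : Plane} (h : p ≠ q) :
    volume {x : Plane | dist x p = dist x q} = 0 := by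
  have h1 : {x : Plane | dist x p = dist x q} = (AffineSubspace.perpBisector p q : Set Plane) := by
    ext x
    exact AffineSubspace.mem_perpBisector_iff_dist_eq.symm
  rw [h1]
  exact Measure.addHaar_affineSubspace volume _
    fun ht => h (AffineSubspace.perpBisector_eq_top.1 ht)

theorem aedisjoint_serviceRegion {X : Set Plane} {p q : Plane} (hp : p ∈ X) (hq : q ∈ X)
    (h : p ≠ q) : AEDisjoint volume (serviceRegion X p) (serviceRegion X q) :=
  measure_mono_null (fun _ hx => le_antisymm (hx.1 q hq) (hx.2 p hp)) (volume_setOf_dist_eq h)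

theorem IsLayout.volume_serviceRegion_ne_top {X : Set Plane} (hX : IsLayout X) {p : Plane}
    (hp : p ∈ X) : volume (serviceRegion X p) ≠ ⊤ :=
  (hX.bounded p hp).measure_lt_top.ne

theorem integrableOn_dist_of_isBounded {S : Set Plane}
    (hb : Bornology.IsBounded S) (p : Plane) (a b : ℝ) :
    IntegrableOn (fun x => a * dist x p + b) S := by
  have hc : Continuous fun x : Plane => a * dist x p + b := by fun_prop
  obtain ⟨M, hM⟩ := hb.subset_closedBall p
  exact (hc.continuousOn.integrableOn_compact (isCompact_closedBall p M)).mono_set hM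

theorem IsLayout.exists_mem_serviceRegion {X : Set Plane} (hX : IsLayout X) {p₀ : Plane}
    (hp₀ : p₀ ∈ X) (x : Plane) :
    ∃ q ∈ X, ‖q‖ ≤ 2 * ‖x‖ + ‖p₀‖ ∧ x ∈ serviceRegion X q := by
  have hfin := hX.locallyFinite (2 * ‖x‖ + ‖p₀‖)
  have hp₀' : p₀ ∈ X ∩ Metric.closedBall 0 (2 * ‖x‖ + ‖p₀‖) :=
    ⟨hp₀, mem_closedBall_zero_iff.2 (by linarith [norm_nonneg x])⟩
  obtain ⟨q, hq, hmin⟩ := hfin.exists_minimalFor (fun q => dist x q) _ ⟨p₀, hp₀'⟩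
  have hmin' : ∀ r ∈ X ∩ Metric.closedBall 0 (2 * ‖x‖ + ‖p₀‖), dist x q ≤ dist x r := fun r hr =>
    (le_total (dist x q) (dist x r)).elim id (hmin hr)
  refine ⟨q, hq.1, mem_closedBall_zero_iff.1 hq.2, fun r hr => ?_⟩
  by_cases h : ‖r‖ ≤ 2 * ‖x‖ + ‖p₀‖
  · exact hmin' r ⟨hr, mem_closedBall_zero_iff.2 h⟩
  · have h1 := hmin' p₀ hp₀'
    have h2 : dist x p₀ ≤ ‖x‖ + ‖p₀‖ := dist_le_norm_add_norm x p₀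
    have h3 : ‖r‖ - ‖x‖ ≤ dist x r := by
      rw [dist_comm, dist_eq_norm]; exact norm_sub_norm_le r x
    linarith

theorem volume_real_closedBall (r : ℝ) (hr : 0 ≤ r) :
    volume.real (Metric.closedBall (0 : Plane) r) = Real.pi * r ^ 2 := by
  rw [measureReal_def, EuclideanSpace.volume_closedBall_fin_two, ENNReal.toReal_mul,
    ENNReal.toReal_pow, ENNReal.toReal_ofReal hr]
  rw [ENNReal.toReal_ofReal Real.pi_pos.le, mul_comm]

theorem sum_volume_real_eq_of_aedisjoint (P : Finset Plane) (A : Plane → Set Plane)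
    (hm : ∀ p ∈ P, MeasurableSet (A p)) (hf : ∀ p ∈ P, volume (A p) ≠ ⊤)
    (hd : Set.Pairwise (P : Set Plane) (Function.onFun (AEDisjoint volume) A)) :
    ∑ p ∈ P, volume.real (A p) = volume.real (⋃ p ∈ P, A p) :=
  (measureReal_biUnion_finset₀ hd (fun p hp => (hm p hp).nullMeasurableSet) hf).symm

/-- The regions of the facilities within distance `R` of the origin cover a disc. -/
theorem IsLayout.le_sum_volume_serviceRegion {X : Set Plane} (hX : IsLayout X) {p₀ : Plane}
    (hp₀ : p₀ ∈ X) {R : ℝ} (hR : ‖p₀‖ ≤ R) (P : Finset Plane)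
    (hP : (P : Set Plane) = X ∩ Metric.closedBall 0 R) :
    Real.pi * ((R - ‖p₀‖) / 2) ^ 2 ≤ ∑ p ∈ P, volume.real (serviceRegion X p) := by
  have hPX : ∀ p ∈ P, p ∈ X := fun p hp => (hP.subset (Finset.mem_coe.2 hp)).1
  rw [sum_volume_real_eq_of_aedisjoint P _ (fun p _ => measurableSet_serviceRegion X p)
    (fun p hp => hX.volume_serviceRegion_ne_top (hPX p hp))
    (fun p hp q hq hpq => aedisjoint_serviceRegion (hPX p hp) (hPX q hq) hpq),
    ← volume_real_closedBall _ (by linarith)]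
  refine measureReal_mono ?_ ?_
  · intro x hx
    have hx := mem_closedBall_zero_iff.1 hx
    obtain ⟨q, hq, hqn, hxq⟩ := hX.exists_mem_serviceRegion hp₀ x
    have hqP : q ∈ (P : Set Plane) := by
      rw [hP]; exact ⟨hq, mem_closedBall_zero_iff.2 (by linarith)⟩
    exact Set.mem_biUnion hqP hxq
  · exact ((measure_biUnion_finset_le _ _).trans_lt (ENNReal.sum_lt_top.2 fun p hp =>
      (hX.volume_serviceRegion_ne_top (hPX p hp)).lt_top)).ne

theorem two_pi_mul_angleCost_sub_sectorGain {κ s : ℝ}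
    (hκs : κ * s ^ 3 * (3 * √3 / 4 * (2 / 3 + Real.log 3 / 2)) = 2) :
    κ * s ^ 3 * (2 * Real.pi * angleCost 1 - 6 * sectorGain (Real.pi / 6)) = -1 := by
  have h3 : √3 ^ 3 = 3 * √3 := by
    rw [pow_succ, Real.sq_sqrt (by norm_num)]
  rw [sectorGain, secPrimitive_pi_div_six, Real.sin_pi_div_six, Real.cos_pi_div_six, angleCost,
    hexRatio, div_pow, h3]
  linear_combination (-1 / 2 : ℝ) * hκs

/-- The key estimate: the total cost of the facilities within distance `R` of the origin, with the
served area credited at the rate `κ * hexRatio * s`, is bounded below by a boundary term. Passing to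
the Voronoi cells of the finitely many facilities in question, truncated at distance `s`, only
affects points near the circle of radius `R`, and these finite diagrams have at most `6` neighbours
per facility on average. -/
theorem IsLayout.le_sum_cost {X : Set Plane} (hX : IsLayout X) {κ s : ℝ} (hκ : 0 < κ) (hs : 0 < s)
    (hκs : κ * s ^ 3 * (3 * √3 / 4 * (2 / 3 + Real.log 3 / 2)) = 2) {R : ℝ} (hR : s ≤ R)
    (P : Finset Plane) (hP : (P : Set Plane) = X ∩ Metric.closedBall 0 R) :
    κ * hexRatio * s * ∑ p ∈ P, volume.real (serviceRegion X p) - κ * s * (4 * Real.pi * s * R) ≤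
      ∑ p ∈ P, (1 + κ * ∫ x in serviceRegion X p, ‖x - p‖) := by
  set lam := κ * hexRatio * s with hlam
  have hl0 : 0 < lam := by
    have := two_thirds_lt_hexRatio
    have : 0 < hexRatio := by linarith
    positivity
  have hl1 : lam ≤ κ * s := by
    have : κ * s * hexRatio ≤ κ * s * 1 := by
      have := hexRatio_lt_one
      gcongr
    rw [hlam]; linarith
  have hPX : ∀ p ∈ P, p ∈ X := fun p hp => (hP.subset (Finset.mem_coe.2 hp)).1
  let E : Plane → Set Plane := fun p =>
    (serviceRegion P p \ serviceRegion X p) ∩ Metric.closedBall p s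
  have hEm : ∀ p, MeasurableSet (E p) := fun p =>
    ((measurableSet_serviceRegion P p).diff (measurableSet_serviceRegion X p)).inter
      measurableSet_closedBall
  have hEf : ∀ p, volume (E p) ≠ ⊤ := fun p =>
    ((measure_mono Set.inter_subset_right).trans_lt measure_closedBall_lt_top).ne
  have hEsub : ∀ p ∈ P, E p ⊆ Metric.closedBall 0 (R + s) \ Metric.closedBall 0 (R - s) := by
    rintro p hp x ⟨⟨hx1, hx2⟩, hx3⟩
    have hpR : ‖p‖ ≤ R := mem_closedBall_zero_iff.1 (hP.subset (Finset.mem_coe.2 hp)).2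
    have hxp : dist x p ≤ s := hx3
    refine ⟨mem_closedBall_zero_iff.2 ?_, fun hx => ?_⟩
    · have := norm_le_norm_add_norm_sub' x p
      rw [← dist_eq_norm] at this
      linarith
    · have hx := mem_closedBall_zero_iff.1 hx
      simp only [serviceRegion, Set.mem_ofPred_eq, not_forall, not_le] at hx2
      obtain ⟨q, hq, hlt⟩ := hx2
      have hqR : ‖q‖ ≤ R := by
        have := norm_le_norm_add_norm_sub' q x
        rw [← dist_eq_norm, dist_comm] at this
        linarith
      have hqP : q ∈ (P : Set Plane) := by rw [hP]; exact ⟨hq, mem_closedBall_zero_iff.2 hqR⟩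
      exact absurd (hx1 q hqP) (not_le.2 hlt)
  have hEsum : ∑ p ∈ P, volume.real (E p) ≤ 4 * Real.pi * s * R := by
    rw [sum_volume_real_eq_of_aedisjoint P E (fun p _ => hEm p) (fun p _ => hEf p)
      (fun p hp q hq hpq => (aedisjoint_serviceRegion hp hq hpq).mono
        (fun x hx => hx.1.1) (fun x hx => hx.1.1))]
    calc volume.real (⋃ p ∈ P, E p)
        ≤ volume.real (Metric.closedBall (0 : Plane) (R + s) \ Metric.closedBall 0 (R - s)) :=
          measureReal_mono (Set.iUnion₂_subset hEsub)
            ((measure_mono Set.sdiff_subset).trans_lt measure_closedBall_lt_top).ne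
      _ = 4 * Real.pi * s * R := by
          rw [measureReal_sdiff (Metric.closedBall_subset_closedBall (by linarith))
            measurableSet_closedBall measure_closedBall_lt_top.ne,
            volume_real_closedBall _ (by linarith),
            volume_real_closedBall _ (by linarith)]
          ring
  have hcell : ∀ p ∈ P, κ * s ^ 3 * (2 * Real.pi * angleCost 1
      - (voronoiNeighbors P p).card * sectorGain (Real.pi / 6)) - κ * s * volume.real (E p) ≤
      κ * (∫ x in serviceRegion X p, ‖x - p‖) - lam * volume.real (serviceRegion X p) := by
    intro p hp
    set A := serviceRegion X p
    set B := Metric.closedBall p s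
    have hAm : MeasurableSet A := measurableSet_serviceRegion X p
    have hBm : MeasurableSet B := measurableSet_closedBall
    have hAA' : A ⊆ serviceRegion P p := fun x hx q hq => hx q (hPX q hq)
    have hAb : Bornology.IsBounded A := hX.bounded p (hPX p hp)
    have hAint := integrableOn_dist_of_isBounded hAb p κ (-lam)
    have hBint := integrableOn_dist_of_isBounded
      ((Metric.isBounded_closedBall (x := p) (r := s)).subset
        (Set.inter_subset_right (s := serviceRegion P p))) p κ (-lam)
    have hval : ∫ x in A, (κ * dist x p + -lam) =
        κ * (∫ x in A, ‖x - p‖) - lam * volume.real A := by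
      have h1 := integrableOn_dist_of_isBounded hAb p κ 0
      simp only [add_zero] at h1
      rw [integral_add h1 (integrableOn_const (hX.volume_serviceRegion_ne_top (hPX p hp))),
        integral_const_mul, setIntegral_const]
      simp only [dist_eq_norm, smul_eq_mul]
      ring
    have hout : 0 ≤ ∫ x in A \ B, (κ * dist x p + -lam) := by
      refine setIntegral_nonneg (hAm.diff hBm) fun x hx => ?_
      have : s < dist x p := not_le.1 fun h => hx.2 h
      nlinarith
    have hE : ∫ x in E p, (κ * dist x p + -lam) ≤ κ * s * volume.real (E p) := by
      refine (Real.le_norm_self _).trans (norm_setIntegral_le_of_norm_le_const (hEf p).lt_top ?_)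
      intro x hx
      have h1 : dist x p ≤ s := hx.2
      have h2 : κ * dist x p ≤ κ * s := by gcongr
      have h3 : 0 ≤ κ * dist x p := by positivity
      rw [Real.norm_eq_abs, abs_le]
      constructor <;> linarith
    have hsplit1 := integral_inter_add_sdiff hBm hAint
    have hsplit2 := integral_inter_add_sdiff hAm hBint
    have e1 : serviceRegion P p ∩ B ∩ A = A ∩ B := by
      ext x
      exact ⟨fun h => ⟨h.2, h.1.2⟩, fun h => ⟨⟨hAA' h.1, h.2⟩, h.1⟩⟩
    have e2 : (serviceRegion P p ∩ B) \ A = E p := by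
      ext x
      exact ⟨fun h => ⟨⟨h.1.1, h.2⟩, h.1.2⟩, fun h => ⟨⟨h.1.1, h.2⟩, h.1.2⟩⟩
    rw [e1, e2] at hsplit2
    have hmain := le_setIntegral_serviceRegion_inter_closedBall P (p := p) hκ hs
    rw [← hlam] at hmain
    linarith
  have hsum := Finset.sum_le_sum hcell
  simp only [Finset.sum_sub_distrib, ← Finset.mul_sum, ← Finset.sum_mul, Finset.sum_const,
    nsmul_eq_mul] at hsum
  have hnb : (∑ p ∈ P, ((voronoiNeighbors P p).card : ℝ)) ≤ 6 * P.card := by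
    exact_mod_cast sum_card_voronoiNeighbors_le P
  have hgain := mul_le_mul_of_nonneg_right hnb sectorGain_pi_div_six_nonneg
  have hks : 0 < κ * s ^ 3 := by positivity
  have hgain' := mul_le_mul_of_nonneg_left hgain hks.le
  have hconst := two_pi_mul_angleCost_sub_sectorGain hκs
  have hconst' : κ * s ^ 3 * (P.card * (2 * Real.pi * angleCost 1)
      - 6 * P.card * sectorGain (Real.pi / 6)) = -P.card := by
    linear_combination (P.card : ℝ) * hconst
  have hE' := mul_le_mul_of_nonneg_left hEsum (show 0 ≤ κ * s by positivity)
  rw [Finset.sum_add_distrib, ← Finset.mul_sum, Finset.sum_const, nsmul_one]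
  linarith

/-- No layout beats the cost per unit area of the optimal hexagons. -/
theorem IsLayout.le_averageCost {X : Set Plane} (hX : IsLayout X) {f κ s : ℝ} (hf : 0 < f)
    (hκ : 0 < κ) (hs : 0 < s)
    (hκs : κ * s ^ 3 * (3 * √3 / 4 * (2 / 3 + Real.log 3 / 2)) = 2) :
    ((f * (κ * hexRatio * s) : ℝ) : EReal) ≤ averageCost f κ X := by
  have hpi := Real.pi_pos
  obtain ⟨p₀, hp₀⟩ := hX.nonempty
  set lam := κ * hexRatio * s
  set C := κ * s * (4 * Real.pi * s) with hC
  have hlow : Tendsto (fun R : ℝ => ((f * lam - f * (16 * C / Real.pi) / R : ℝ) : EReal)) atTop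
      (𝓝 ((f * lam : ℝ) : EReal)) := by
    refine (continuous_coe_real_ereal.tendsto _).comp ?_
    have := (tendsto_const_nhds (x := f * (16 * C / Real.pi)) (f := atTop)).div_atTop tendsto_id
    simpa using tendsto_const_nhds.sub this
  rw [← hlow.liminf_eq]
  refine liminf_le_liminf ?_
  filter_upwards [eventually_ge_atTop (2 * ‖p₀‖), eventually_ge_atTop s, eventually_gt_atTop 0]
    with R h1 h2 h3
  rw [EReal.coe_le_coe_iff, costPerArea, finsum_mem_eq_finite_toFinset_sum _ (hX.locallyFinite R),
    finsum_mem_eq_finite_toFinset_sum _ (hX.locallyFinite R)]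
  set P := (hX.locallyFinite R).toFinset
  have hP : (P : Set Plane) = X ∩ Metric.closedBall 0 R := Set.Finite.coe_toFinset _
  have hcost := hX.le_sum_cost hκ hs hκs h2 P hP
  have harea := hX.le_sum_volume_serviceRegion hp₀ (by linarith [norm_nonneg p₀]) P hP
  set S := ∑ p ∈ P, volume.real (serviceRegion X p)
  set T := ∑ p ∈ P, (1 + κ * ∫ x in serviceRegion X p, ‖x - p‖)
  have hS : Real.pi * R ^ 2 / 16 ≤ S := by
    refine le_trans ?_ harea
    have : R / 4 ≤ (R - ‖p₀‖) / 2 := by linarith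
    have := pow_le_pow_left₀ (by positivity) this 2
    nlinarith
  have hS0 : 0 < S := lt_of_lt_of_le (by positivity) hS
  have hCR : C * R ≤ 16 * C / Real.pi / R * S := by
    calc C * R = 16 * C / Real.pi / R * (Real.pi * R ^ 2 / 16) := by field_simp
      _ ≤ _ := by gcongr
  have hT : (lam - 16 * C / Real.pi / R) * S ≤ T := by
    have : κ * s * (4 * Real.pi * s * R) = C * R := by rw [hC]; ring
    linarith
  calc f * lam - f * (16 * C / Real.pi) / R = f / S * ((lam - 16 * C / Real.pi / R) * S) := by
        field_simp
    _ ≤ f / S * T := by gcongr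

/-! ### Regular hexagons -/

theorem pi_div_three_pos : 0 < Real.pi / 3 := by positivity

/-- The angle between the direction `θ` and the nearest of the six apothems of a regular hexagon
with a vertex in direction `φ`, with sign. -/
noncomputable def apothemAngle (φ θ : ℝ) : ℝ :=
  toIcoMod pi_div_three_pos (-(Real.pi / 6)) (θ - φ - Real.pi / 6)

theorem apothemAngle_mem (φ θ : ℝ) :
    -(Real.pi / 6) ≤ apothemAngle φ θ ∧ apothemAngle φ θ < Real.pi / 6 := by
  have := toIcoMod_mem_Ico pi_div_three_pos (-(Real.pi / 6)) (θ - φ - Real.pi / 6)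
  exact ⟨this.1, by have := this.2; unfold apothemAngle; linarith⟩

theorem exists_eq_apothemAngle_add (φ θ : ℝ) :
    ∃ k : ℤ, θ = φ + Real.pi / 6 + k * (Real.pi / 3) + apothemAngle φ θ := by
  refine ⟨toIcoDiv pi_div_three_pos (-(Real.pi / 6)) (θ - φ - Real.pi / 6), ?_⟩
  have := self_sub_toIcoDiv_mul pi_div_three_pos (-(Real.pi / 6)) (θ - φ - Real.pi / 6)
  unfold apothemAngle
  linarith

theorem sqrt_three_div_two_le_cos_apothemAngle (φ θ : ℝ) :
    √3 / 2 ≤ Real.cos (apothemAngle φ θ) := by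
  obtain ⟨h1, h2⟩ := apothemAngle_mem φ θ
  rw [← Real.cos_pi_div_six, ← Real.cos_abs (apothemAngle φ θ)]
  exact Real.cos_le_cos_of_nonneg_of_le_pi (abs_nonneg _) (by linarith [Real.pi_pos])
    (abs_le.2 ⟨h1, h2.le⟩)

theorem regularPolygon_six_eq (p : Plane) (s φ : ℝ) : regularPolygon 6 p s φ =
    convexHull ℝ (Set.range fun k : ℤ => p + s • unitVec (φ + k * (Real.pi / 3))) := by
  unfold regularPolygon
  congr 1
  apply Set.Subset.antisymm
  · rintro _ ⟨k, rfl⟩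
    refine ⟨((k : ℕ) : ℤ), ?_⟩
    have : φ + 2 * Real.pi * ((k : ℕ) : ℝ) / (6 : ℕ) = φ + ((k : ℕ) : ℤ) * (Real.pi / 3) := by
      push_cast; ring
    simp only [unitVec, this]
  · rintro _ ⟨k, rfl⟩
    have h0 : 0 ≤ k % 6 := Int.emod_nonneg _ (by norm_num)
    have h6 : k % 6 < 6 := Int.emod_lt_of_pos _ (by norm_num)
    refine ⟨⟨(k % 6).toNat, by omega⟩, ?_⟩
    have hk : (((k % 6).toNat : ℤ) : ℝ) = k - 6 * (k / 6 : ℤ) := by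
      rw [Int.toNat_of_nonneg h0, Int.emod_def]; push_cast; ring
    have hk' : (((k % 6).toNat : ℕ) : ℝ) = k - 6 * (k / 6 : ℤ) := by exact_mod_cast hk
    have : φ + k * (Real.pi / 3) =
        φ + 2 * Real.pi * ((k % 6).toNat : ℕ) / (6 : ℕ) + (k / 6 : ℤ) * (2 * Real.pi) := by
      rw [hk']; push_cast; ring
    simp only [unitVec, this, Real.cos_add_int_mul_two_pi, Real.sin_add_int_mul_two_pi]

theorem isBounded_regularPolygon_six (p : Plane) (s φ : ℝ) :
    Bornology.IsBounded (regularPolygon 6 p s φ) :=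
  isBounded_convexHull.2 (Set.finite_range _).isBounded

/-- The projections of the vertices to an apothem direction: the cosine of an odd multiple of
`π / 6` is one of `0` and `± √3 / 2`. -/
theorem cos_int_mul_sub_le (m : ℤ) : Real.cos (m * (Real.pi / 3) - Real.pi / 6) ≤ √3 / 2 := by
  have h : Real.cos (3 * (m * (Real.pi / 3) - Real.pi / 6)) = 0 := by
    rw [Real.cos_eq_zero_iff]
    exact ⟨m - 1, by push_cast; ring⟩
  rw [Real.cos_three_mul] at h
  set c := Real.cos (m * (Real.pi / 3) - Real.pi / 6)
  have h3 : (√3) ^ 2 = 3 := Real.sq_sqrt (by norm_num)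
  by_contra hcon
  rw [not_le] at hcon
  have h0 : 0 < √3 := by positivity
  have : 0 < c * (c ^ 2 - (√3 / 2) ^ 2) := by
    apply mul_pos (by linarith)
    nlinarith
  nlinarith

theorem le_of_mem_regularPolygon_six {p x : Plane} {s φ : ℝ} (hs : 0 ≤ s)
    (hx : x ∈ regularPolygon 6 p s φ) (k : ℤ) :
    (x 0 - p 0) * Real.cos (φ + Real.pi / 6 + k * (Real.pi / 3))
      + (x 1 - p 1) * Real.sin (φ + Real.pi / 6 + k * (Real.pi / 3)) ≤ s * (√3 / 2) := by
  rw [regularPolygon_six_eq] at hx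
  set ν := φ + Real.pi / 6 + k * (Real.pi / 3) with hν
  have hconv : Convex ℝ {x : Plane | (x 0 - p 0) * Real.cos ν + (x 1 - p 1) * Real.sin ν
      ≤ s * (√3 / 2)} := by
    intro x hx y hy a b ha hb hab
    simp only [Set.mem_ofPred_eq, PiLp.add_apply, PiLp.smul_apply, smul_eq_mul] at hx hy ⊢
    have h1 := mul_le_mul_of_nonneg_left hx ha
    have h2 := mul_le_mul_of_nonneg_left hy hb
    have hb' : b = 1 - a := by linarith
    subst hb'
    linarith
  refine convexHull_min ?_ hconv hx
  rintro _ ⟨j, rfl⟩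
  have hc := cos_int_mul_sub_le (j - k)
  have he : ((j - k : ℤ) : ℝ) * (Real.pi / 3) - Real.pi / 6 = φ + j * (Real.pi / 3) - ν := by
    rw [hν]; push_cast; ring
  rw [he, Real.cos_sub] at hc
  simp only [Set.mem_ofPred_eq, unitVec, PiLp.add_apply, PiLp.smul_apply, Matrix.cons_val_zero,
    Matrix.cons_val_one, smul_eq_mul, add_sub_cancel_left]
  have := mul_le_mul_of_nonneg_left hc hs
  linarith

theorem self_mem_regularPolygon_six (p : Plane) (s φ : ℝ) : p ∈ regularPolygon 6 p s φ := by
  rw [regularPolygon_six_eq]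
  have h0 := subset_convexHull ℝ (Set.range fun k : ℤ => p + s • unitVec (φ + k * (Real.pi / 3)))
    ⟨0, rfl⟩
  have h3 := subset_convexHull ℝ (Set.range fun k : ℤ => p + s • unitVec (φ + k * (Real.pi / 3)))
    ⟨3, rfl⟩
  have := convex_convexHull ℝ _ h0 h3 (show (0 : ℝ) ≤ 1 / 2 by norm_num)
    (show (0 : ℝ) ≤ 1 / 2 by norm_num) (by norm_num)
  convert this using 1
  have h : unitVec (φ + (3 : ℤ) * (Real.pi / 3)) = -unitVec (φ + (0 : ℤ) * (Real.pi / 3)) := by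
    ext i
    fin_cases i <;> simp [unitVec, mul_div_cancel₀]
  simp only [h]
  module

/-- A point of the sector around an apothem is a convex combination of the centre and the two
vertices next to that apothem. -/
theorem mem_regularPolygon_six_of_le {p : Plane} {s φ r θ : ℝ} (hs : 0 < s) (hr : 0 ≤ r)
    (h : r * Real.cos (apothemAngle φ θ) ≤ s * (√3 / 2)) :
    p + r • unitVec θ ∈ regularPolygon 6 p s φ := by
  obtain ⟨k, hk⟩ := exists_eq_apothemAngle_add φ θ
  obtain ⟨h1, h2⟩ := apothemAngle_mem φ θ
  set τ := apothemAngle φ θ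
  have hpi := Real.pi_pos
  have hp := self_mem_regularPolygon_six p s φ
  rw [regularPolygon_six_eq] at hp ⊢
  have hv0 := subset_convexHull ℝ (Set.range fun k : ℤ => p + s • unitVec (φ + k * (Real.pi / 3)))
    ⟨k, rfl⟩
  have hv1 := subset_convexHull ℝ (Set.range fun k : ℤ => p + s • unitVec (φ + k * (Real.pi / 3)))
    ⟨k + 1, rfl⟩
  have ha : 0 ≤ Real.sin (Real.pi / 6 - τ) :=
    Real.sin_nonneg_of_nonneg_of_le_pi (by linarith) (by linarith)
  have hb : 0 ≤ Real.sin (Real.pi / 6 + τ) :=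
    Real.sin_nonneg_of_nonneg_of_le_pi (by linarith) (by linarith)
  set a := r / s * (Real.sin (Real.pi / 6 - τ) * (2 / √3)) with ha'
  set b := r / s * (Real.sin (Real.pi / 6 + τ) * (2 / √3)) with hb'
  have ha0 : 0 ≤ a := by positivity
  have hb0 : 0 ≤ b := by positivity
  have hab : a + b ≤ 1 := by
    have : a + b = r * Real.cos τ / (s * (√3 / 2)) := by
      rw [ha', hb', Real.sin_sub, Real.sin_add, Real.sin_pi_div_six, Real.cos_pi_div_six]
      field_simp
      ring
    rw [this, div_le_one (by positivity)]
    exact h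
  have hmem := (convex_convexHull ℝ (Set.range fun k : ℤ =>
    p + s • unitVec (φ + k * (Real.pi / 3)))).sum_mem (t := Finset.univ)
    (w := ![1 - a - b, a, b]) (z := ![p, p + s • unitVec (φ + k * (Real.pi / 3)),
      p + s • unitVec (φ + ((k + 1 : ℤ) : ℝ) * (Real.pi / 3))])
    (by intro i _; fin_cases i <;> simp <;> linarith) (by simp [Fin.sum_univ_three]; ring)
    (by intro i _; fin_cases i; exacts [hp, hv0, hv1])
  convert hmem using 1
  have hcomb : r • unitVec θ = (a * s) • unitVec (φ + k * (Real.pi / 3)) +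
      (b * s) • unitVec (φ + ((k + 1 : ℤ) : ℝ) * (Real.pi / 3)) := by
    have e0 : φ + k * (Real.pi / 3) = (φ + Real.pi / 6 + k * (Real.pi / 3)) - Real.pi / 6 := by
      ring
    have e1 : φ + ((k + 1 : ℤ) : ℝ) * (Real.pi / 3) =
        (φ + Real.pi / 6 + k * (Real.pi / 3)) + Real.pi / 6 := by
      push_cast; ring
    rw [e0, e1, hk]
    generalize φ + Real.pi / 6 + k * (Real.pi / 3) = ν
    ext i
    fin_cases i
    · simp only [unitVec, PiLp.add_apply, PiLp.smul_apply, smul_eq_mul, Fin.zero_eta,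
        Matrix.cons_val_zero, ha', hb', Real.sin_sub, Real.sin_add, Real.cos_add, Real.cos_sub,
        Real.sin_pi_div_six, Real.cos_pi_div_six]
      field_simp
      ring
    · simp only [unitVec, PiLp.add_apply, PiLp.smul_apply, smul_eq_mul, Fin.mk_one,
        Matrix.cons_val_one, Matrix.cons_val_zero, ha', hb', Real.sin_sub, Real.sin_add,
        Real.sin_pi_div_six, Real.cos_pi_div_six]
      field_simp
      ring
  rw [hcomb]
  simp only [Fin.sum_univ_three, Matrix.cons_val_zero, Matrix.cons_val_one, Matrix.cons_val]
  module

theorem add_smul_unitVec_mem_regularPolygon_six_iff {p : Plane} {s φ r θ : ℝ} (hs : 0 < s)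
    (hr : 0 ≤ r) : p + r • unitVec θ ∈ regularPolygon 6 p s φ ↔
      r ≤ s * (√3 / 2) / Real.cos (apothemAngle φ θ) := by
  have hc : 0 < Real.cos (apothemAngle φ θ) :=
    lt_of_lt_of_le (by positivity) (sqrt_three_div_two_le_cos_apothemAngle φ θ)
  rw [le_div_iff₀ hc]
  refine ⟨fun h => ?_, mem_regularPolygon_six_of_le hs hr⟩
  obtain ⟨k, hk⟩ := exists_eq_apothemAngle_add φ θ
  have := le_of_mem_regularPolygon_six hs.le h k
  have he : apothemAngle φ θ = θ - (φ + Real.pi / 6 + k * (Real.pi / 3)) := by linarith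
  rw [he, Real.cos_sub]
  simp only [unitVec, PiLp.add_apply, PiLp.smul_apply, Matrix.cons_val_zero, Matrix.cons_val_one,
    smul_eq_mul, add_sub_cancel_left] at this
  linarith

/-- Integration over a regular hexagon in polar coordinates, reduced to one of its twelve
congruent right triangles. -/
theorem setIntegral_regularPolygon_six (p : Plane) {s φ : ℝ} (hs : 0 < s) (a b : ℝ) :
    ∫ x in regularPolygon 6 p s φ, (a * dist x p + b) =
      12 * ∫ u in (0 : ℝ)..(Real.pi / 6), (a * (s * (√3 / 2) / Real.cos u) ^ 3 / 3
        + b * (s * (√3 / 2) / Real.cos u) ^ 2 / 2) := by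
  have hpi := Real.pi_pos
  have hmeas : MeasurableSet (regularPolygon 6 p s φ) := by
    have : IsCompact (regularPolygon 6 p s φ) := (Set.finite_range _).isCompact_convexHull ℝ
    exact this.measurableSet
  set d := s * (√3 / 2) with hd
  have hcpos : ∀ θ, 0 < Real.cos (apothemAngle φ θ) := fun θ =>
    lt_of_lt_of_le (by positivity) (sqrt_three_div_two_le_cos_apothemAngle φ θ)
  have hρ : ∀ θ, 0 ≤ d / Real.cos (apothemAngle φ θ) ∧ d / Real.cos (apothemAngle φ θ) ≤ s := by
    intro θ
    have := hcpos θ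
    refine ⟨by positivity, ?_⟩
    rw [div_le_iff₀ this, hd]
    have := sqrt_three_div_two_le_cos_apothemAngle φ θ
    gcongr
  obtain ⟨hint, hval⟩ := setIntegral_starShaped p hmeas
    (fun θ => d / Real.cos (apothemAngle φ θ)) hρ
    (fun θ r hr => add_smul_unitVec_mem_regularPolygon_six_iff hs hr.le) a b
  rw [hval]
  set U : ℝ → ℝ := fun u => a * (d / Real.cos u) ^ 3 / 3 + b * (d / Real.cos u) ^ 2 / 2 with hU
  have hper : Function.Periodic (fun θ => U (apothemAngle φ θ)) (Real.pi / 3) := by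
    intro θ
    have : apothemAngle φ (θ + Real.pi / 3) = apothemAngle φ θ := by
      unfold apothemAngle
      rw [show θ + Real.pi / 3 - φ - Real.pi / 6 = θ - φ - Real.pi / 6 + Real.pi / 3 by ring,
        toIcoMod_add_right]
    simp only [this]
  have hint1 : IntervalIntegrable (fun θ => U (apothemAngle φ θ)) volume (-Real.pi)
      (-Real.pi + Real.pi / 3) := by
    refine hint.mono_set ?_
    rw [Set.uIcc_of_le (by linarith), Set.uIcc_of_le (by linarith)]
    exact Set.Icc_subset_Icc le_rfl (by linarith)
  have hall := hper.intervalIntegrable pi_div_three_pos.ne' hint1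
  have h6 := hper.intervalIntegral_add_zsmul_eq 6 (-Real.pi) hall
  rw [show -Real.pi + (6 : ℤ) • (Real.pi / 3) = Real.pi by rw [zsmul_eq_mul]; push_cast; ring,
    hper.intervalIntegral_add_eq (-Real.pi) φ] at h6
  have hone : ∫ θ in φ..(φ + Real.pi / 3), U (apothemAngle φ θ) =
      ∫ θ in φ..(φ + Real.pi / 3), U (θ - (φ + Real.pi / 6)) := by
    rw [intervalIntegral.integral_of_le (by linarith),
      intervalIntegral.integral_of_le (by linarith), integral_Ioc_eq_integral_Ioo,
      integral_Ioc_eq_integral_Ioo]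
    refine setIntegral_congr_fun measurableSet_Ioo fun θ hθ => ?_
    have : apothemAngle φ θ = θ - φ - Real.pi / 6 := by
      unfold apothemAngle
      rw [toIcoMod_eq_self]
      exact ⟨by linarith [hθ.1], by linarith [hθ.2]⟩
    simp only [this, sub_sub]
  have hUc : ContinuousOn U (Set.Icc (-(Real.pi / 6)) (Real.pi / 6)) := by
    have : ContinuousOn (fun u => d / Real.cos u) (Set.Icc (-(Real.pi / 6)) (Real.pi / 6)) :=
      continuousOn_const.div Real.continuous_cos.continuousOn fun u hu =>
        (Real.cos_pos_of_mem_Ioo ⟨by linarith [hu.1], by linarith [hu.2]⟩).ne'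
    simp only [hU]
    fun_prop
  have heven : ∫ u in (-(Real.pi / 6))..0, U u = ∫ u in (0 : ℝ)..(Real.pi / 6), U u := by
    have := intervalIntegral.integral_comp_neg (a := 0) (b := Real.pi / 6) U
    rw [neg_zero] at this
    rw [← this]
    simp only [hU, Real.cos_neg]
  have hhalf : ∫ θ in φ..(φ + Real.pi / 3), U (θ - (φ + Real.pi / 6)) =
      2 * ∫ u in (0 : ℝ)..(Real.pi / 6), U u := by
    rw [intervalIntegral.integral_comp_sub_right U,
      show φ - (φ + Real.pi / 6) = -(Real.pi / 6) by ring,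
      show φ + Real.pi / 3 - (φ + Real.pi / 6) = Real.pi / 6 by ring,
      ← intervalIntegral.integral_add_adjacent_intervals (b := 0), heven]
    · ring
    · apply ContinuousOn.intervalIntegrable
      rw [Set.uIcc_of_le (by linarith)]
      exact hUc.mono (Set.Icc_subset_Icc le_rfl (by linarith))
    · apply ContinuousOn.intervalIntegrable
      rw [Set.uIcc_of_le (by linarith)]
      exact hUc.mono (Set.Icc_subset_Icc (by linarith) le_rfl)
  rw [hone, hhalf] at h6
  rw [h6, zsmul_eq_mul]
  push_cast
  ring

theorem volume_real_regularPolygon_six (p : Plane) {s φ : ℝ} (hs : 0 < s) :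
    volume.real (regularPolygon 6 p s φ) = 3 * √3 / 2 * s ^ 2 := by
  have h := setIntegral_regularPolygon_six p (φ := φ) hs 0 1
  have hpi := Real.pi_pos
  simp only [zero_mul, zero_add, zero_div, one_mul, setIntegral_const, smul_eq_mul,
    mul_one] at h
  rw [h, intervalIntegral.integral_eq_sub_of_hasDerivAt
    (f := fun u => (s * (√3 / 2)) ^ 2 / 2 * Real.tan u)]
  · simp only [Real.tan_zero, Real.tan_pi_div_six]
    field_simp
    ring
  · intro u hu
    rw [Set.uIcc_of_le (by linarith)] at hu
    have hc : Real.cos u ≠ 0 :=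
      (Real.cos_pos_of_mem_Ioo ⟨by linarith [hu.1], by linarith [hu.2]⟩).ne'
    refine ((Real.hasDerivAt_tan hc).const_mul ((s * (√3 / 2)) ^ 2 / 2)).congr_deriv ?_
    rw [div_pow]; ring
  · apply ContinuousOn.intervalIntegrable
    rw [Set.uIcc_of_le (by linarith)]
    refine ContinuousOn.div_const (ContinuousOn.pow (continuousOn_const.div
      Real.continuous_cos.continuousOn fun u hu => ?_) 2) 2
    exact (Real.cos_pos_of_mem_Ioo ⟨by linarith [hu.1], by linarith [hu.2]⟩).ne'

theorem setIntegral_norm_regularPolygon_six (p : Plane) {s φ : ℝ} (hs : 0 < s) :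
    ∫ x in regularPolygon 6 p s φ, ‖x - p‖ =
      s ^ 3 * (3 * √3 / 4 * (2 / 3 + Real.log 3 / 2)) := by
  have h := setIntegral_regularPolygon_six p (φ := φ) hs 1 0
  have hpi := Real.pi_pos
  simp only [zero_mul, add_zero, zero_div, one_mul, dist_eq_norm] at h
  rw [h, intervalIntegral.integral_eq_sub_of_hasDerivAt
    (f := fun u => (s * (√3 / 2)) ^ 3 / 6 * (Real.sin u / Real.cos u ^ 2 + secPrimitive u))]
  · have h3 : (√3) ^ 3 = 3 * √3 := by rw [pow_succ, Real.sq_sqrt (by norm_num)]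
    have h32 : (√3) ^ 2 = 3 := Real.sq_sqrt (by norm_num)
    simp only [Real.sin_zero, secPrimitive_zero, secPrimitive_pi_div_six, Real.sin_pi_div_six,
      Real.cos_pi_div_six, div_pow, mul_pow, h3, h32]
    ring
  · intro u hu
    rw [Set.uIcc_of_le (by linarith)] at hu
    have hc := Real.cos_pos_of_mem_Ioo
      (show u ∈ Set.Ioo (-(Real.pi / 2)) (Real.pi / 2) from
        ⟨by linarith [hu.1], by linarith [hu.2]⟩)
    have hs2 : Real.sin u ^ 2 = 1 - Real.cos u ^ 2 := by linarith [Real.sin_sq_add_cos_sq u]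
    refine ((((Real.hasDerivAt_sin u).div ((Real.hasDerivAt_cos u).pow 2)
      (pow_ne_zero 2 hc.ne')).add (hasDerivAt_secPrimitive hc)).const_mul
        ((s * (√3 / 2)) ^ 3 / 6)).congr_deriv ?_
    simp only [Pi.pow_apply]
    push_cast
    field_simp
    ring_nf
    rw [hs2]
    ring
  · apply ContinuousOn.intervalIntegrable
    rw [Set.uIcc_of_le (by linarith)]
    refine ContinuousOn.div_const (ContinuousOn.pow (continuousOn_const.div
      Real.continuous_cos.continuousOn fun u hu => ?_) 3) 3
    exact (Real.cos_pos_of_mem_Ioo ⟨by linarith [hu.1], by linarith [hu.2]⟩).ne'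

/-! ### The triangular lattice -/

/-- The point with coordinates `i`, `j` of the triangular lattice with edge length `l`. -/
noncomputable def latticePoint (l : ℝ) (i j : ℤ) : Plane := !₂[l * (i + j / 2), l * (j * (√3 / 2))]

/-- The triangular lattice with edge length `l`. -/
def triangularLattice (l : ℝ) : Set Plane := {x | ∃ i j : ℤ, x = latticePoint l i j}

theorem latticePoint_add (l : ℝ) (i j i' j' : ℤ) :
    latticePoint l i j + latticePoint l i' j' = latticePoint l (i + i') (j + j') := by
  ext k
  fin_cases k <;> simp [latticePoint] <;> ring

/-- The lattice contains the six vectors of length `l` in the directions `m * (π / 3)`. -/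
theorem exists_smul_unitVec_eq_latticePoint (l : ℝ) (m : ℤ) :
    ∃ i j : ℤ, l • unitVec (m * (Real.pi / 3)) = latticePoint l i j := by
  have h3 : √3 * √3 = 3 := Real.mul_self_sqrt (by norm_num)
  suffices h : ∃ i j : ℤ, Real.cos (m * (Real.pi / 3)) = i + j / 2 ∧
      Real.sin (m * (Real.pi / 3)) = j * (√3 / 2) by
    obtain ⟨i, j, hc, hs⟩ := h
    refine ⟨i, j, ?_⟩
    ext k
    fin_cases k <;> simp [latticePoint, unitVec, hc, hs]
  induction m using Int.induction_on with
  | zero => exact ⟨1, 0, by simp, by simp⟩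
  | succ m ih =>
    obtain ⟨i, j, hc, hs⟩ := ih
    refine ⟨-j, i + j, ?_, ?_⟩
    · rw [Int.cast_add, Int.cast_one, add_mul, one_mul, Real.cos_add, hc, hs, Real.cos_pi_div_three,
        Real.sin_pi_div_three]
      push_cast
      linear_combination (-(j : ℝ) / 4) * h3
    · rw [Int.cast_add, Int.cast_one, add_mul, one_mul, Real.sin_add, hc, hs, Real.cos_pi_div_three,
        Real.sin_pi_div_three]
      push_cast
      ring
  | pred m ih =>
    obtain ⟨i, j, hc, hs⟩ := ih
    refine ⟨i + j, -i, ?_, ?_⟩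
    · rw [Int.cast_sub, Int.cast_one, sub_mul, one_mul, Real.cos_sub, hc, hs, Real.cos_pi_div_three,
        Real.sin_pi_div_three]
      push_cast
      linear_combination ((j : ℝ) / 4) * h3
    · rw [Int.cast_sub, Int.cast_one, sub_mul, one_mul, Real.sin_sub, hc, hs, Real.cos_pi_div_three,
        Real.sin_pi_div_three]
      push_cast
      ring

theorem int_le_sq_add_mul_add_sq (i j : ℤ) : i ≤ i ^ 2 + i * j + j ^ 2 := by
  rcases le_or_gt i 0 with h | h
  · nlinarith [sq_nonneg (i + 2 * j), sq_nonneg i]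
  rcases eq_or_lt_of_le (Int.add_one_le_iff.2 h) with h1 | h1
  · have : i = 1 := by omega
    subst this
    rcases le_or_gt 0 j with hj | hj
    · nlinarith
    · nlinarith
  · nlinarith [sq_nonneg (i + 2 * j)]

/-- A point on the near side of the bisectors with the six shortest lattice vectors is on the near
side of the bisectors with all of them. -/
theorem mul_add_mul_le_of_abs_le {A B c : ℝ} (hA : |A| ≤ c) (hB : |B| ≤ c) (hAB : |B - A| ≤ c)
    (i j : ℤ) : i * A + j * B ≤ c * ((i : ℝ) ^ 2 + i * j + (j : ℝ) ^ 2) := by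
  have hc : 0 ≤ c := (abs_nonneg A).trans hA
  obtain ⟨hA1, hA2⟩ := abs_le.1 hA
  obtain ⟨hB1, hB2⟩ := abs_le.1 hB
  obtain ⟨hC1, hC2⟩ := abs_le.1 hAB
  have key : ∀ m : ℤ, m ≤ i ^ 2 + i * j + j ^ 2 →
      c * (m : ℝ) ≤ c * ((i : ℝ) ^ 2 + i * j + (j : ℝ) ^ 2) := by
    intro m hm
    have : (m : ℝ) ≤ (i : ℝ) ^ 2 + i * j + (j : ℝ) ^ 2 := by exact_mod_cast hm
    gcongr
  have k1 := key i (int_le_sq_add_mul_add_sq i j)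
  have k2 := key j (by linarith [int_le_sq_add_mul_add_sq j i])
  have k3 := key (i + j) (by linarith [int_le_sq_add_mul_add_sq (i + j) (-i)])
  have k4 := key (-i) (by linarith [int_le_sq_add_mul_add_sq (-i) (-j)])
  have k5 := key (-j) (by linarith [int_le_sq_add_mul_add_sq (-j) (-i)])
  have k6 := key (-(i + j)) (by linarith [int_le_sq_add_mul_add_sq (-(i + j)) i])
  push_cast at k1 k2 k3 k4 k5 k6
  rcases le_total (0 : ℝ) i with hi | hi <;> rcases le_total (0 : ℝ) j with hj | hj
  · nlinarith
  · rcases le_total (0 : ℝ) (i + j) with hij | hij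
    · nlinarith
    · nlinarith
  · rcases le_total (0 : ℝ) (i + j) with hij | hij
    · nlinarith
    · nlinarith
  · nlinarith

theorem serviceRegion_triangularLattice {s : ℝ} (hs : 0 < s) {p : Plane}
    (hp : p ∈ triangularLattice (s * √3)) :
    serviceRegion (triangularLattice (s * √3)) p = regularPolygon 6 p s (Real.pi / 6) := by
  have h3 : √3 * √3 = 3 := Real.mul_self_sqrt (by norm_num)
  have hpos : 0 < s * (√3 / 2) := by positivity
  obtain ⟨i₀, j₀, hp₀⟩ := hp
  apply Set.Subset.antisymm
  · intro x hx
    by_cases hxp : x = p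
    · rw [hxp]; exact self_mem_regularPolygon_six _ _ _
    obtain ⟨r, θ, hr, hv⟩ := exists_eq_smul_unitVec (sub_ne_zero.2 hxp)
    have hx' : x = p + r • unitVec θ := by rw [← hv]; abel
    obtain ⟨k, hk⟩ := exists_eq_apothemAngle_add (Real.pi / 6) θ
    obtain ⟨i, j, hij⟩ := exists_smul_unitVec_eq_latticePoint (s * √3) (k + 1)
    have hq : p + (2 * (s * (√3 / 2))) • unitVec ((k + 1 : ℤ) * (Real.pi / 3)) ∈
        triangularLattice (s * √3) := by
      refine ⟨i₀ + i, j₀ + j, ?_⟩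
      rw [show 2 * (s * (√3 / 2)) = s * √3 by ring, hij, hp₀, latticePoint_add]
    have := hx _ hq
    rw [hx'] at this ⊢
    rw [dist_le_dist_add_smul_iff p hpos] at this
    refine mem_regularPolygon_six_of_le hs hr.le ?_
    convert this using 3
    push_cast
    linarith
  · rintro x hx q ⟨i₁, j₁, hq⟩
    set i := i₁ - i₀
    set j := j₁ - j₀
    have hqp : q = p + latticePoint (s * √3) i j := by
      rw [hq, hp₀, latticePoint_add]; simp [i, j]
    set u := x 0 - p 0 with hu
    set v := x 1 - p 1 with hv
    have b (k : ℤ) := le_of_mem_regularPolygon_six hs.le hx k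
    have b0 := b (-1)
    have b1 := b 0
    have b2 := b 1
    have b3 := b 2
    have b4 := b 3
    have b5 := b 4
    rw [show Real.pi / 6 + Real.pi / 6 + ((-1 : ℤ) : ℝ) * (Real.pi / 3) = 0 by
      push_cast; ring, Real.cos_zero, Real.sin_zero] at b0
    rw [show Real.pi / 6 + Real.pi / 6 + ((0 : ℤ) : ℝ) * (Real.pi / 3) = Real.pi / 3 by
      push_cast; ring, Real.cos_pi_div_three, Real.sin_pi_div_three] at b1
    rw [show Real.pi / 6 + Real.pi / 6 + ((1 : ℤ) : ℝ) * (Real.pi / 3) = Real.pi - Real.pi / 3 by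
      push_cast; ring, Real.cos_pi_sub, Real.sin_pi_sub, Real.cos_pi_div_three,
      Real.sin_pi_div_three] at b2
    rw [show Real.pi / 6 + Real.pi / 6 + ((2 : ℤ) : ℝ) * (Real.pi / 3) = Real.pi by
      push_cast; ring, Real.cos_pi, Real.sin_pi] at b3
    rw [show Real.pi / 6 + Real.pi / 6 + ((3 : ℤ) : ℝ) * (Real.pi / 3) = Real.pi / 3 + Real.pi by
      push_cast; ring, Real.cos_add_pi, Real.sin_add_pi, Real.cos_pi_div_three,
      Real.sin_pi_div_three] at b4
    rw [show Real.pi / 6 + Real.pi / 6 + ((4 : ℤ) : ℝ) * (Real.pi / 3) =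
      2 * Real.pi - Real.pi / 3 by
      push_cast; ring, Real.cos_two_pi_sub, Real.sin_two_pi_sub, Real.cos_pi_div_three,
      Real.sin_pi_div_three] at b5
    have hA : |u| ≤ s * (√3 / 2) := abs_le.2 ⟨by linarith, by linarith⟩
    have hB : |u / 2 + v * (√3 / 2)| ≤ s * (√3 / 2) := abs_le.2 ⟨by linarith, by linarith⟩
    have hAB : |u / 2 + v * (√3 / 2) - u| ≤ s * (√3 / 2) := abs_le.2 ⟨by linarith, by linarith⟩
    have hmain := mul_add_mul_le_of_abs_le hA hB hAB i j
    have hmain' := mul_le_mul_of_nonneg_left hmain (show 0 ≤ 2 * (s * √3) by positivity)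
    rw [dist_le_dist_iff_sitePower, hqp]
    have e0 : x 0 = p 0 + u := by rw [hu]; ring
    have e1 : x 1 = p 1 + v := by rw [hv]; ring
    simp only [sitePower, latticePoint, PiLp.add_apply, Matrix.cons_val_zero, Matrix.cons_val_one,
      e0, e1]
    linear_combination hmain' - (s ^ 2 * √3 ^ 2 * (j : ℝ) ^ 2 / 4) * h3

theorem isLayout_triangularLattice {s : ℝ} (hs : 0 < s) :
    IsLayout (triangularLattice (s * √3)) where
  nonempty := ⟨_, 0, 0, rfl⟩
  bounded p hp := by
    rw [serviceRegion_triangularLattice hs hp]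
    exact isBounded_regularPolygon_six _ _ _
  locallyFinite R := by
    set l := s * √3
    have hl0 : 0 < l := by positivity
    obtain ⟨N, hN⟩ := exists_nat_ge (R ^ 2 / l ^ 2)
    refine ((Set.finite_Icc (-(N : ℤ)) N).prod (Set.finite_Icc (-(N : ℤ)) N)).image
      (fun z : ℤ × ℤ => latticePoint l z.1 z.2) |>.subset ?_
    rintro _ ⟨⟨i, j, rfl⟩, hR⟩
    have h3 : √3 ^ 2 = 3 := Real.sq_sqrt (by norm_num)
    have hnorm : ‖latticePoint l i j‖ ^ 2 = l ^ 2 * ((i : ℝ) ^ 2 + i * j + (j : ℝ) ^ 2) := by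
      rw [EuclideanSpace.norm_sq_eq]
      simp only [Fin.sum_univ_two, latticePoint, Matrix.cons_val_zero, Matrix.cons_val_one,
        Real.norm_eq_abs, sq_abs]
      linear_combination (l ^ 2 * (j : ℝ) ^ 2 / 4) * h3
    have hle : (i : ℝ) ^ 2 + i * j + (j : ℝ) ^ 2 ≤ N := by
      refine le_trans ?_ hN
      rw [le_div_iff₀ (by positivity), mul_comm, ← hnorm]
      exact pow_le_pow_left₀ (norm_nonneg _) (mem_closedBall_zero_iff.1 hR) 2
    have hle' : i ^ 2 + i * j + j ^ 2 ≤ N := by exact_mod_cast hle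
    have a1 := int_le_sq_add_mul_add_sq i j
    have a2 := int_le_sq_add_mul_add_sq j i
    have a3 := int_le_sq_add_mul_add_sq (-i) (-j)
    have a4 := int_le_sq_add_mul_add_sq (-j) (-i)
    exact ⟨(i, j), ⟨⟨by linarith, by linarith⟩, ⟨by linarith, by linarith⟩⟩, rfl⟩

theorem hasHexagonalRegions_triangularLattice {s : ℝ} (hs : 0 < s) :
    HasHexagonalRegions (triangularLattice (s * √3)) (3 * √3 / 2 * s ^ 2) := by
  intro p hp
  rw [serviceRegion_triangularLattice hs hp]
  exact ⟨⟨s, _, hs, rfl⟩, volume_real_regularPolygon_six p hs⟩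

/-! ### Cost of hexagonal layouts -/

/-- All hexagons of a hexagonal layout have the same circumradius, and the cost per unit area is
that of a single one of them. -/
theorem IsLayout.exists_costPerArea_eq {X : Set Plane} (hX : IsLayout X) {a : ℝ}
    (h : HasHexagonalRegions X a) (f κ : ℝ) : ∃ s, 0 < s ∧ a = 3 * √3 / 2 * s ^ 2 ∧
      ∀ᶠ R in atTop, costPerArea f κ X R =
        f * (1 + κ * (s ^ 3 * (3 * √3 / 4 * (2 / 3 + Real.log 3 / 2)))) / a := by
  obtain ⟨p₀, hp₀⟩ := hX.nonempty
  have hcell : ∀ p ∈ X, ∃ s φ : ℝ, 0 < s ∧ serviceRegion X p = regularPolygon 6 p s φ ∧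
      a = 3 * √3 / 2 * s ^ 2 := by
    intro p hp
    obtain ⟨⟨s, φ, hs, hreg⟩, hvol⟩ := h p hp
    refine ⟨s, φ, hs, hreg, ?_⟩
    rw [← hvol, hreg, volume_real_regularPolygon_six p hs]
  obtain ⟨s, -, hs, -, ha⟩ := hcell p₀ hp₀
  have ha0 : 0 < a := by rw [ha]; positivity
  refine ⟨s, hs, ha, ?_⟩
  filter_upwards [eventually_ge_atTop ‖p₀‖] with R hR
  rw [costPerArea, finsum_mem_eq_finite_toFinset_sum _ (hX.locallyFinite R),
    finsum_mem_eq_finite_toFinset_sum _ (hX.locallyFinite R)]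
  set P := (hX.locallyFinite R).toFinset
  have hPX : ∀ p ∈ P, p ∈ X := fun p hp => ((Set.Finite.mem_toFinset _).1 hp).1
  have hp₀P : p₀ ∈ P := (Set.Finite.mem_toFinset _).2 ⟨hp₀, mem_closedBall_zero_iff.2 hR⟩
  have hcard : (0 : ℝ) < P.card := Nat.cast_pos.2 (Finset.card_pos.2 ⟨p₀, hp₀P⟩)
  rw [Finset.sum_congr rfl fun p hp => (h p (hPX p hp)).2, Finset.sum_const,
    Finset.sum_congr rfl (g := fun _ =>
      1 + κ * (s ^ 3 * (3 * √3 / 4 * (2 / 3 + Real.log 3 / 2)))), Finset.sum_const]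
  · simp only [nsmul_eq_mul]
    field_simp
  · intro p hp
    obtain ⟨s', φ, hs', hreg, ha'⟩ := hcell p (hPX p hp)
    have : s' = s := by
      have h1 : 3 * √3 / 2 * s' ^ 2 = 3 * √3 / 2 * s ^ 2 := ha'.symm.trans ha
      have h2 := mul_left_cancel₀ (by positivity) h1
      exact (pow_left_inj₀ hs'.le hs.le two_ne_zero).1 h2
    rw [hreg, setIntegral_norm_regularPolygon_six p hs', this]

theorem gFun_six_sq_mul : 0 < gFun 6 ∧ gFun 6 ^ 2 * (2 / 3 + Real.log 3 / 2) ^ 2 = 6 * √3 := by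
  have hB : 0 < 2 / 3 + Real.log 3 / 2 := by
    have := Real.log_pos (show (1 : ℝ) < 3 by norm_num)
    positivity
  have h3 : √3 * √3 = 3 := Real.mul_self_sqrt (by norm_num)
  have h30 : 0 < √3 := by positivity
  have hlog : Real.log (√3) = Real.log 3 / 2 := Real.log_sqrt (by norm_num)
  have hg : gFun 6 = 3 * (6 : ℝ) ^ (1 / 2 : ℝ) * (1 / √3) ^ (3 / 2 : ℝ) *
      (2 / 3 + Real.log 3 / 2)⁻¹ := by
    have e : Real.log (Real.tan (Real.pi / (2 * 6) + Real.pi / 4)) +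
        Real.tan (Real.pi / 6) / Real.cos (Real.pi / 6) = 2 / 3 + Real.log 3 / 2 := by
      rw [show Real.pi / (2 * 6) + Real.pi / 4 = Real.pi / 3 by ring, Real.tan_pi_div_three, hlog,
        Real.tan_pi_div_six, Real.cos_pi_div_six]
      have : 1 / √3 / (√3 / 2) = 2 / 3 := by
        rw [div_div_div_eq, one_mul, ← mul_comm, h3]
      rw [this]; ring
    rw [gFun, e, Real.tan_pi_div_six]
  refine ⟨by rw [hg]; positivity, ?_⟩
  have e1 : ((6 : ℝ) ^ (1 / 2 : ℝ)) ^ 2 = 6 := by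
    rw [← Real.rpow_natCast, ← Real.rpow_mul (by norm_num)]; norm_num
  have e2 : ((1 / √3 : ℝ) ^ (3 / 2 : ℝ)) ^ 2 = (1 / √3) ^ 3 := by
    rw [← Real.rpow_natCast, ← Real.rpow_mul (by positivity), ← Real.rpow_natCast]; norm_num
  rw [hg, mul_pow, mul_pow, mul_pow, e1, e2]
  field_simp
  nlinarith

/-- The circumradius of the optimal hexagons: the one for which the outbound cost of a facility is
twice its set-up cost. -/
theorem exists_optimal_circumradius {κ : ℝ} (hκ : 0 < κ) : ∃ s, 0 < s ∧
    κ * s ^ 3 * (3 * √3 / 4 * (2 / 3 + Real.log 3 / 2)) = 2 ∧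
    optimalArea κ = 3 * √3 / 2 * s ^ 2 ∧
    ∀ f, 0 < f → optimalCost f κ = f * (κ * hexRatio * s) := by
  have hlog := Real.log_pos (show (1 : ℝ) < 3 by norm_num)
  set B := 2 / 3 + Real.log 3 / 2 with hB
  have hB0 : 0 < B := by positivity
  obtain ⟨hg, hgB⟩ := gFun_six_sq_mul
  rw [← hB] at hgB
  set g := gFun 6
  have h3 : √3 ^ 2 = 3 := Real.sq_sqrt (by norm_num)
  have h30 : 0 < √3 := by positivity
  set y := 2 / (κ * (3 * √3 / 4 * B)) with hy
  have hy0 : 0 < y := by positivity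
  set s := y ^ (1 / 3 : ℝ)
  have hs0 : 0 < s := by positivity
  have hs3 : s ^ 3 = y := by
    rw [← Real.rpow_natCast, ← Real.rpow_mul hy0.le]; norm_num
  have hκs : κ * s ^ 3 * (3 * √3 / 4 * B) = 2 := by
    rw [hs3, hy]; field_simp
  have hcube : ∀ {a b : ℝ}, 0 ≤ a → 0 ≤ b → a ^ 3 = b ^ 3 → a = b := fun ha hb h =>
    (pow_left_inj₀ ha hb three_ne_zero).1 h
  -- Squaring the defining equation of `s` removes the root of `3`.
  have hsq : κ ^ 2 * (s ^ 3) ^ 2 * B ^ 2 * 27 = 64 := by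
    have h := congrArg (fun z => z ^ 2 * 16) hκs
    have : (κ * s ^ 3 * (3 * √3 / 4 * B)) ^ 2 = κ ^ 2 * (s ^ 3) ^ 2 * B ^ 2 * 9 / 16 * √3 ^ 2 := by
      ring
    rw [this, h3] at h
    linarith
  refine ⟨s, hs0, hκs, ?_, fun f hf => ?_⟩
  · refine hcube (by unfold optimalArea; positivity) (by positivity) ?_
    have e1 : ((κ / 2) ^ (-(2 / 3) : ℝ)) ^ 3 = ((κ / 2) ^ 2)⁻¹ := by
      rw [← Real.rpow_natCast, ← Real.rpow_mul (by positivity), ← Real.rpow_natCast,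
        ← Real.rpow_neg (by positivity)]
      norm_num
    have e2 : (g ^ (2 / 3 : ℝ)) ^ 3 = g ^ 2 := by
      rw [← Real.rpow_natCast, ← Real.rpow_mul hg.le, ← Real.rpow_natCast]; norm_num
    rw [optimalArea, mul_pow, e1, e2]
    have h4 : κ ^ 2 * B ^ 2 * (((κ / 2) ^ 2)⁻¹ * g ^ 2) =
        κ ^ 2 * B ^ 2 * (3 * √3 / 2 * s ^ 2) ^ 3 := by
      have e3 : κ ^ 2 * B ^ 2 * (((κ / 2) ^ 2)⁻¹ * g ^ 2) = 4 * (g ^ 2 * B ^ 2) := by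
        field_simp
        ring
      have e4 : κ ^ 2 * B ^ 2 * (3 * √3 / 2 * s ^ 2) ^ 3 =
          (κ ^ 2 * (s ^ 3) ^ 2 * B ^ 2 * 27) * (√3 ^ 2 * √3) / 8 := by ring
      rw [e3, e4, hgB, hsq, h3]; ring
    exact mul_left_cancel₀ (by positivity) h4
  · have hℓ : hexRatio = 3 / 4 * B := by rw [hexRatio, hB]; ring
    have hr0 : 0 < hexRatio := by rw [hℓ]; positivity
    refine hcube (by unfold optimalCost; positivity) (by positivity) ?_
    have e1 : ((κ ^ 2 * f ^ 3 / (4 * g ^ 2)) ^ (1 / 3 : ℝ)) ^ 3 = κ ^ 2 * f ^ 3 / (4 * g ^ 2) := by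
      rw [← Real.rpow_natCast, ← Real.rpow_mul (by positivity)]; norm_num
    have hg2 : g ^ 2 = 6 * √3 / B ^ 2 := by field_simp; linarith
    rw [optimalCost, mul_pow, e1, hℓ, hg2]
    have e2 : (f * (κ * (3 / 4 * B) * s)) ^ 3 * √3 =
        f ^ 3 * κ ^ 2 * B ^ 2 * (κ * s ^ 3 * (3 * √3 / 4 * B)) * (9 / 16) := by ring
    have e3 : 3 ^ 3 * (κ ^ 2 * f ^ 3 / (4 * (6 * √3 / B ^ 2))) * √3 =
        f ^ 3 * κ ^ 2 * B ^ 2 * (9 / 8) := by field_simp; ring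
    refine mul_right_cancel₀ h30.ne' (e3.trans ?_)
    rw [e2, hκs]; ring

theorem mainTheorem1 (f κ : ℝ) (hf : 0 < f) (hκ : 0 < κ) :
    -- the minimal cost per unit area over all layouts exists and has the stated value
    IsLeast {z : EReal | ∃ X : Set Plane, IsLayout X ∧ averageCost f κ X = z}
      ((optimalCost f κ : ℝ) : EReal) ∧
    -- the plane can be served by identical regular hexagons of the stated area
    (∃ X : Set Plane, IsLayout X ∧ HasHexagonalRegions X (optimalArea κ)) ∧
    -- every such layout is optimal, and its cost per unit area is a genuine limit
    (∀ X : Set Plane, IsLayout X → HasHexagonalRegions X (optimalArea κ) →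
      IsOptimalLayout f κ X ∧ Tendsto (costPerArea f κ X) atTop (𝓝 (optimalCost f κ))) ∧
    -- no other area is optimal for identical regular hexagons
    (∀ (X : Set Plane) (a : ℝ), IsLayout X → HasHexagonalRegions X a →
      IsOptimalLayout f κ X → a = optimalArea κ) := by
  obtain ⟨s, hs, hκs, harea, hcost⟩ := exists_optimal_circumradius hκ
  have hcost := hcost f hf
  -- A facility with the optimal region costs `3`, in units of the set-up cost.
  have hunit : f * (1 + κ * (s ^ 3 * (3 * √3 / 4 * (2 / 3 + Real.log 3 / 2)))) / optimalArea κ =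
      optimalCost f κ := by
    rw [hcost, harea, hexRatio, div_eq_iff (by positivity)]
    linear_combination (-f / 2 : ℝ) * hκs
  have hlow : ∀ Y, IsLayout Y → ((optimalCost f κ : ℝ) : EReal) ≤ averageCost f κ Y := by
    intro Y hY
    rw [hcost]
    exact hY.le_averageCost hf hκ hs hκs
  have havg : ∀ {X : Set Plane} {c : ℝ}, (∀ᶠ R in atTop, costPerArea f κ X R = c) →
      averageCost f κ X = (c : EReal) := by
    intro X c h
    rw [averageCost, liminf_congr (v := fun _ => (c : EReal)) (h.mono fun R hR => by rw [hR]),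
      liminf_const]
  have hev : ∀ X : Set Plane, IsLayout X → HasHexagonalRegions X (optimalArea κ) →
      ∀ᶠ R in atTop, costPerArea f κ X R = optimalCost f κ := by
    intro X hX hhex
    obtain ⟨s', hs', ha', hev⟩ := hX.exists_costPerArea_eq hhex f κ
    have : s' = s := by
      rw [harea] at ha'
      exact ((pow_left_inj₀ hs.le hs'.le two_ne_zero).1
        (mul_left_cancel₀ (by positivity) ha')).symm
    rw [this, hunit] at hev
    exact hev
  have hlat := isLayout_triangularLattice hs
  have hlathex : HasHexagonalRegions (triangularLattice (s * √3)) (optimalArea κ) := by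
    rw [harea]; exact hasHexagonalRegions_triangularLattice hs
  refine ⟨⟨⟨_, hlat, havg (hev _ hlat hlathex)⟩, ?_⟩, ⟨_, hlat, hlathex⟩, ?_, ?_⟩
  · rintro _ ⟨Y, hY, rfl⟩
    exact hlow Y hY
  · intro X hX hhex
    refine ⟨⟨hX, fun Y hY => ?_⟩, ?_⟩
    · rw [havg (hev X hX hhex)]
      exact hlow Y hY
    · exact tendsto_const_nhds.congr' ((hev X hX hhex).mono fun R hR => hR.symm)
  · intro X a hX hhex hopt
    obtain ⟨s', hs', ha', hev'⟩ := hX.exists_costPerArea_eq hhex f κ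
    have hle := hopt.2 _ hlat
    rw [havg hev', havg (hev _ hlat hlathex), EReal.coe_le_coe_iff, ← hunit] at hle
    set m := 3 * √3 / 4 * (2 / 3 + Real.log 3 / 2)
    rw [harea, ha'] at *
    rw [div_le_div_iff₀ (by positivity) (by positivity)] at hle
    have hm : κ * (s ^ 3 * m) = 2 := by linarith
    have hc : 0 < f * (3 * √3 / 2) := by positivity
    have hle1 : (1 + κ * (s' ^ 3 * m)) * s ^ 2 ≤ 3 * s' ^ 2 := by
      rw [hm] at hle
      refine le_of_mul_le_mul_left ?_ hc
      linarith
    -- With `t = s' / s` the inequality reads `(t - 1) ^ 2 * (2 * t + 1) ≤ 0`.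
    have hle2 : (s' - s) ^ 2 * (2 * s' + s) ≤ 0 := by
      have h1 := mul_le_mul_of_nonneg_right hle1 hs.le
      have h2 : κ * (s' ^ 3 * m) * s ^ 2 * s = 2 * s' ^ 3 := by
        linear_combination s' ^ 3 * hm
      nlinarith
    have hz : (s' - s) ^ 2 = 0 := by
      refine le_antisymm ?_ (sq_nonneg _)
      exact nonpos_of_mul_nonpos_left hle2 (by positivity)
    have : s' = s := by
      have := pow_eq_zero_iff two_ne_zero |>.1 hz
      linarith
    rw [this]
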